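/- Let $d\ge 0$, let $\Omega$ be a compact space with a continuous action $\tau$ of $\mathbb Z^d$ (generators $\tau_1,\dots,\tau_d$), and let $\mathbb P$ be a $\tau$-invariant Borel probability measure on $\Omega$. Let $S_1,\dots,S_d$ be the right shifts on $\ell^2(\mathbb Z^d)$. Let $\mathcal A_0$ be the $*$-algebra of bounded families $A=(A_\omega)_{\omega\in\Omega}$ of bounded operators on $\ell^2(\mathbb Z^d)$ that are strongly continuous in $\omega$, covariant, i.e. $S_jA_\omega S_j^*=A_{\tau_j\omega}$ for $j=1,\dots,d$, and of finite range, i.e. there is an $R$ with $\langle n|A_\omega|m\rangle=0$ for all $\omega$ whenever $|n-m|>R$. Let $\mathcal A$ be the completion of $\mathcal A_0$ in the norm $\|A\|=\sup_\omega\|A_\omega\|$, and put $\mathcal T(A)=\int_\Omega\langle 0|A_\omega|0\rangle\,d\mathbb P(\omega)$. Let $V_n,T_n\in\mathcal A$ ($n\ge1$) with $V_n=V_n^*$, $T_1=\mathbf 1$, and every $T_n$ invertible with bounded inverse ($\sup_\omega\|T_{n,\omega}^{-1}\|<\infty$). For $E\in\mathbb R$ let $$\mathcal M_n^E=\begin{pmatrix}(E\,\mathbf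 1-V_n)T_n^{-1}&-T_n^*\\ T_n^{-1}&\mathbf 0\end{pmatrix},\qquad U_N^E=\left[\binom{\mathbf 1}{\imath\mathbf 1}^*\mathcal M_N^E\cdots\mathcal M_1^E\binom{\mathbf 1}{0}\right]\left[\binom{\mathbf 1}{-\imath\mathbf 1}^*\mathcal M_N^E\cdots\mathcal M_1^E\binom{\mathbf 1}{0}\right]^{-1}.$$ Then for every $N\ge 2$ and every $E\in\mathbb R$ the Prüfer phase $U_N^E$ is well defined (the second bracket is invertible), is a unitary element of $\mathcal A$ and is norm differentiable in $E$; the phase velocity operator $$S_N^E=\frac1{\imath N}\,(U_N^E)^*\,\partial_EU_N^E$$ belongs to $\mathcal A$ and is positive semidefinite, i.e. $(S^E_N)_\omega\ge 0$ for every $\omega\in\Omega$. Moreover $E\mapsto\mathcal T(S_N^E)$ is integrable over $\mathbb R$ and $$\int_{-\infty}^{\infty}\mathcal T(S_N^E)\,dE=2\pi.$$ -/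

import Mathlib

open MeasureTheory
open scoped ENNReal InnerProductSpace

noncomputable section

namespace Prufer

/-- The Hilbert space `ℓ²(ℤ^d)`. -/
abbrev LatticeSpace (d : ℕ) : Type := lp (fun _ : Fin d → ℤ => ℂ) 2

/-- Bounded operators on `ℓ²(ℤ^d)`. -/
abbrev LatticeOp (d : ℕ) : Type := LatticeSpace d →L[ℂ] LatticeSpace d

/-- The canonical basis vector `|n⟩` of `ℓ²(ℤ^d)`. -/
def ket {d : ℕ} (n : Fin d → ℤ) : LatticeSpace d := lp.single 2 n (1 : ℂ)

theorem ket_apply {d : ℕ} (n m : Fin d → ℤ) :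
    (ket n : LatticeSpace d) m = if m = n then 1 else 0 := by
  simp [ket, Pi.single_apply]

/-- The matrix element `⟨n|A|m⟩`. -/
def matrixElement {d : ℕ} (A : LatticeOp d) (n m : Fin d → ℤ) : ℂ :=
  ⟪ket n, A (ket m)⟫_ℂ

theorem inner_ket_left {d : ℕ} (n : Fin d → ℤ) (x : LatticeSpace d) : ⟪ket n, x⟫_ℂ = x n := by
  unfold ket
  rw [lp.inner_single_left]
  simp

theorem inner_ket_right {d : ℕ} (n : Fin d → ℤ) (x : LatticeSpace d) :
    ⟪x, ket n⟫_ℂ = star (x n) := by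
  rw [← inner_conj_symm, inner_ket_left]; rfl

instance (d : ℕ) : Nontrivial (LatticeSpace d) :=
  ⟨⟨ket 0, 0, fun h => by
    have := congrArg (fun f : LatticeSpace d => ⟪ket 0, f⟫_ℂ) h
    simp [ket] at this⟩⟩

theorem memℓp_shift {d : ℕ} (j : Fin d) (x : LatticeSpace d) :
    Memℓp (fun n : Fin d → ℤ => x (n - Pi.single j 1)) 2 := by
  have h : Summable fun n : Fin d → ℤ => ‖x n‖ ^ (2 : ℝ≥0∞).toReal :=
    (lp.memℓp x).summable (by norm_num)
  exact memℓp_gen (h.comp_injective (Equiv.subRight (Pi.single j (1 : ℤ) : Fin d → ℤ)).injective)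

/-- The right shift on `ℓ²(ℤ^d)` in the direction `j`, as a linear map. -/
def shiftLinear {d : ℕ} (j : Fin d) : LatticeSpace d →ₗ[ℂ] LatticeSpace d where
  toFun x := ⟨fun n => x (n - Pi.single j 1), memℓp_shift j x⟩
  map_add' _ _ := rfl
  map_smul' _ _ := rfl

theorem norm_shiftLinear {d : ℕ} (j : Fin d) (x : LatticeSpace d) : ‖shiftLinear j x‖ = ‖x‖ := by
  rw [lp.norm_eq_tsum_rpow (by norm_num), lp.norm_eq_tsum_rpow (by norm_num)]
  congr 1
  exact (Equiv.subRight (Pi.single j (1 : ℤ))).tsum_eq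
    (fun n : Fin d → ℤ => ‖x n‖ ^ (2 : ℝ≥0∞).toReal)

/-- The right shift `S_j` on `ℓ²(ℤ^d)` in the direction `j`: `(S_j x)(n) = x(n - e_j)`, that is
`S_j|n⟩ = |n + e_j⟩`. -/
def shift {d : ℕ} (j : Fin d) : LatticeOp d :=
  (shiftLinear j).mkContinuous 1 (fun x => by rw [one_mul, norm_shiftLinear])

theorem shift_apply {d : ℕ} (j : Fin d) (x : LatticeSpace d) (n : Fin d → ℤ) :
    shift j x n = x (n - Pi.single j 1) := rfl

theorem shift_ket {d : ℕ} (j : Fin d) (m : Fin d → ℤ) :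
    shift j (ket m) = ket (m + Pi.single j 1) := by
  ext n
  simp only [shift_apply, ket_apply, sub_eq_iff_eq_add]

theorem star_shift_apply {d : ℕ} (j : Fin d) (x : LatticeSpace d) (n : Fin d → ℤ) :
    star (shift j) x n = x (n + Pi.single j 1) := by
  rw [← inner_ket_left, ContinuousLinearMap.star_eq_adjoint,
    ContinuousLinearMap.adjoint_inner_right, shift_ket, inner_ket_left]

theorem star_shift_mul_shift {d : ℕ} (j : Fin d) : star (shift j) * shift j = 1 := by
  ext x n
  simp [star_shift_apply, shift_apply]

theorem shift_mul_star_shift {d : ℕ} (j : Fin d) : shift j * star (shift j) = 1 := by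
  ext x n
  simp [star_shift_apply, shift_apply]

/-- The C*-algebra of all bounded families `(A_ω)_{ω ∈ Ω}` of bounded operators on `ℓ²(ℤ^d)`, with
pointwise operations and the norm `‖A‖ = sup_ω ‖A_ω‖`. -/
def BoundedFamily (Ω : Type*) (d : ℕ) : Type _ := lp (fun _ : Ω => LatticeOp d) ∞

namespace BoundedFamily

variable {Ω : Type*} {d : ℕ}

/-- The C*-algebra structure on bounded families: pointwise operations and supremum norm. -/
def cstarAlgebra : CStarAlgebra (BoundedFamily Ω d) where
  __ := (inferInstance : NormedRing (lp (fun _ : Ω => LatticeOp d) ∞))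
  __ := (inferInstance : StarRing (lp (fun _ : Ω => LatticeOp d) ∞))
  __ := (inferInstance : CompleteSpace (lp (fun _ : Ω => LatticeOp d) ∞))
  __ := (inferInstance : CStarRing (lp (fun _ : Ω => LatticeOp d) ∞))
  __ := (inferInstance : NormedAlgebra ℂ (lp (fun _ : Ω => LatticeOp d) ∞))
  __ := (inferInstance : StarModule ℂ (lp (fun _ : Ω => LatticeOp d) ∞))

instance : CStarAlgebra (BoundedFamily Ω d) := cstarAlgebra

instance : CoeFun (BoundedFamily Ω d) (fun _ => Ω → LatticeOp d) := ⟨fun A => A.1⟩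

theorem mul_apply (A B : BoundedFamily Ω d) (ω : Ω) : (A * B) ω = A ω * B ω := rfl

theorem add_apply (A B : BoundedFamily Ω d) (ω : Ω) : (A + B) ω = A ω + B ω := rfl

theorem star_apply (A : BoundedFamily Ω d) (ω : Ω) : (star A) ω = star (A ω) := rfl

theorem algebraMap_apply (c : ℂ) (ω : Ω) :
    (algebraMap ℂ (BoundedFamily Ω d) c) ω = algebraMap ℂ (LatticeOp d) c := rfl

theorem norm_apply_le (A : BoundedFamily Ω d) (ω : Ω) : ‖A ω‖ ≤ ‖A‖ :=
  lp.norm_apply_le_norm (E := fun _ : Ω => LatticeOp d) ENNReal.top_ne_zero A ω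

/-- The covariance relation `S_j A_ω S_j^* = A_{τ_j ω}`; here `τ_j` is the action of `e_j`. -/
def IsCovariant [AddAction (Fin d → ℤ) Ω] (A : BoundedFamily Ω d) : Prop :=
  ∀ (j : Fin d) (ω : Ω), shift j * A ω * star (shift j) = A ((Pi.single j 1 : Fin d → ℤ) +ᵥ ω)

/-- Continuity of `ω ↦ A_ω` in the strong operator topology. -/
def IsStronglyContinuous [TopologicalSpace Ω] (A : BoundedFamily Ω d) : Prop :=
  ∀ x : LatticeSpace d, Continuous fun ω => A ω x

/-- Finite range: `⟨n|A_ω|m⟩ = 0` for all `ω` as soon as `|n - m| > R`. -/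
def HasFiniteRange (A : BoundedFamily Ω d) : Prop :=
  ∃ R : ℝ, ∀ (ω : Ω) (n m : Fin d → ℤ), R < dist n m → matrixElement (A ω) n m = 0

theorem IsCovariant.mul [AddAction (Fin d → ℤ) Ω] {A B : BoundedFamily Ω d}
    (hA : A.IsCovariant) (hB : B.IsCovariant) : (A * B).IsCovariant := fun j ω => by
  rw [mul_apply, mul_apply, ← hA, ← hB]
  have h : shift j * A ω * star (shift j) * (shift j * B ω * star (shift j))
      = shift j * A ω * (star (shift j) * shift j) * B ω * star (shift j) := by
    simp only [mul_assoc]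
  rw [h, star_shift_mul_shift]
  simp only [mul_assoc, one_mul]

theorem IsStronglyContinuous.mul [TopologicalSpace Ω] {A B : BoundedFamily Ω d}
    (hA : A.IsStronglyContinuous) (hB : B.IsStronglyContinuous) :
    (A * B).IsStronglyContinuous := fun x => by
  rw [continuous_iff_continuousAt]
  intro ω₀
  have h1 : Filter.Tendsto (fun ω => ‖A‖ * ‖B ω x - B ω₀ x‖ + ‖A ω (B ω₀ x) - A ω₀ (B ω₀ x)‖)
      (nhds ω₀) (nhds 0) := by
    have h2 := (hB x).tendsto ω₀
    have h3 := (hA (B ω₀ x)).tendsto ω₀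
    rw [tendsto_iff_norm_sub_tendsto_zero] at h2 h3
    simpa using (h2.const_mul ‖A‖).add h3
  rw [ContinuousAt, tendsto_iff_norm_sub_tendsto_zero]
  refine squeeze_zero (fun _ => norm_nonneg _) (fun ω => ?_) h1
  have h4 : (A * B) ω x - (A * B) ω₀ x
      = A ω (B ω x - B ω₀ x) + (A ω (B ω₀ x) - A ω₀ (B ω₀ x)) := by
    simp [mul_apply]
  rw [h4]
  refine (norm_add_le _ _).trans (add_le_add ?_ le_rfl)
  exact ((A ω).le_opNorm _).trans
    (mul_le_mul_of_nonneg_right (A.norm_apply_le ω) (norm_nonneg _))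

theorem matrixElement_star (A : LatticeOp d) (n m : Fin d → ℤ) :
    matrixElement (star A) n m = star (matrixElement A m n) := by
  unfold matrixElement
  rw [ContinuousLinearMap.star_eq_adjoint, ContinuousLinearMap.adjoint_inner_right,
    ← inner_conj_symm]
  rfl

theorem HasFiniteRange.mul {A B : BoundedFamily Ω d}
    (hA : A.HasFiniteRange) (hB : B.HasFiniteRange) : (A * B).HasFiniteRange := by
  obtain ⟨R, hR⟩ := hA
  obtain ⟨R', hR'⟩ := hB
  refine ⟨R + R', fun ω n m h => ?_⟩
  have h1 : matrixElement ((A * B) ω) n m = ⟪star (A ω) (ket n), B ω (ket m)⟫_ℂ := by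
    rw [ContinuousLinearMap.star_eq_adjoint, ContinuousLinearMap.adjoint_inner_left]
    rfl
  rw [h1, lp.inner_eq_tsum]
  refine (tsum_congr fun k => ?_).trans tsum_zero
  by_cases hk : R < dist n k
  · have h2 : star (A ω) (ket n) k = 0 := by
      have := matrixElement_star (A ω) k n
      rw [hR ω n k hk, star_zero] at this
      rwa [matrixElement, inner_ket_left] at this
    rw [h2, inner_zero_left]
  · have h2 : B ω (ket m) k = 0 := by
      have := hR' ω k m (by linarith [dist_triangle n k m])
      rwa [matrixElement, inner_ket_left] at this
    rw [h2, inner_zero_right]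

theorem HasFiniteRange.adjoint {A : BoundedFamily Ω d} (hA : A.HasFiniteRange) :
    (star A).HasFiniteRange := by
  obtain ⟨R, hR⟩ := hA
  refine ⟨R, fun ω n m h => ?_⟩
  rw [star_apply, matrixElement_star, hR ω m n (by rwa [dist_comm]), star_zero]

theorem hasSum_ket (x : LatticeSpace d) : HasSum (fun n => x n • (ket n : LatticeSpace d)) x := by
  have h := lp.hasSum_single (E := fun _ : Fin d → ℤ => ℂ) (p := 2) (by norm_num) x
  have he : (fun n => x n • (ket n : LatticeSpace d)) = fun n => lp.single 2 n (x n) := by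
    funext n
    rw [ket, ← lp.single_smul, smul_eq_mul, mul_one]
  rwa [he]

theorem IsStronglyContinuous.adjoint [TopologicalSpace Ω] {A : BoundedFamily Ω d}
    (hA : A.IsStronglyContinuous) (hR : A.HasFiniteRange) :
    (star A).IsStronglyContinuous := by
  have hket : ∀ n : Fin d → ℤ, Continuous fun ω => (star A) ω (ket n) := by
    intro n
    obtain ⟨R, hR⟩ := hR.adjoint
    have hfin : (Metric.closedBall n R).Finite := (isCompact_closedBall n R).finite_of_discrete
    have h : ∀ ω, (star A) ω (ket n)
        = ∑ m ∈ hfin.toFinset, matrixElement ((star A) ω) m n • ket m := by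
      intro ω
      refine (hasSum_ket ((star A) ω (ket n))).unique ?_
      have := hasSum_sum_of_ne_finset_zero (L := .unconditional _) (s := hfin.toFinset)
        (f := fun m => ((star A) ω (ket n)) m • (ket m : LatticeSpace d)) (fun m hm => by
          have h0 := hR ω m n (by simpa using hm)
          rw [matrixElement, inner_ket_left] at h0
          rw [h0, zero_smul])
      simpa only [matrixElement, inner_ket_left] using this
    simp_rw [h]
    refine continuous_finsetSum _ fun m _ => Continuous.smul (f := fun ω => matrixElement ((star A) ω) m n)
      (g := fun _ => (ket m : LatticeSpace d)) ?_ continuous_const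
    simp_rw [star_apply, matrixElement_star]
    exact (continuous_const.inner (hA (ket m))).star
  intro x
  refine continuous_of_uniform_approx_of_continuous fun u hu => ?_
  obtain ⟨ε, hε, hεu⟩ := Metric.mem_uniformity_dist.1 hu
  have hpos : 0 < ε / (‖A‖ + 1) := div_pos hε (by positivity)
  obtain ⟨s, hs⟩ := (Metric.tendsto_nhds.1 (hasSum_ket x) _ hpos).exists
  refine ⟨fun ω => (star A) ω (∑ n ∈ s, x n • ket n), ?_, fun ω => hεu ?_⟩
  · simp_rw [map_sum, map_smul]
    exact continuous_finsetSum _ fun n _ => Continuous.smul (f := fun _ => x n)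
      (g := fun ω => (star A) ω (ket n)) continuous_const (hket n)
  · rw [dist_comm, dist_eq_norm] at hs
    rw [dist_eq_norm, ← map_sub]
    calc _ ≤ ‖(star A) ω‖ * ‖x - ∑ n ∈ s, x n • ket n‖ := ContinuousLinearMap.le_opNorm _ _
      _ ≤ (‖A‖ + 1) * ‖x - ∑ n ∈ s, x n • ket n‖ := by
        refine mul_le_mul_of_nonneg_right ?_ (norm_nonneg _)
        have := (star A).norm_apply_le ω
        rw [norm_star] at this
        linarith
      _ < ε := by rwa [lt_div_iff₀' (by positivity)] at hs

end BoundedFamily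

section Algebra

variable (Ω : Type*) [TopologicalSpace Ω] (d : ℕ) [AddAction (Fin d → ℤ) Ω]

/-- The *-algebra `𝒜₀` of strongly continuous covariant families of finite range. -/
def finiteRangeAlgebra : StarSubalgebra ℂ (BoundedFamily Ω d) where
  carrier := {A | A.IsStronglyContinuous ∧ A.IsCovariant ∧ A.HasFiniteRange}
  mul_mem' hA hB := ⟨hA.1.mul hB.1, hA.2.1.mul hB.2.1, hA.2.2.mul hB.2.2⟩
  add_mem' := by
    rintro A B ⟨hA, hA', R, hR⟩ ⟨hB, hB', R', hR'⟩
    refine ⟨fun x => (hA x).add (hB x), fun j ω => ?_, max R R', fun ω n m h => ?_⟩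
    · simp only [BoundedFamily.add_apply, mul_add, add_mul, hA' j ω, hB' j ω]
    · have h1 := hR ω n m ((le_max_left _ _).trans_lt h)
      have h2 := hR' ω n m ((le_max_right _ _).trans_lt h)
      rw [matrixElement, inner_ket_left] at h1 h2 ⊢
      change A ω (ket m) n + B ω (ket m) n = 0
      rw [h1, h2, add_zero]
  algebraMap_mem' c := by
    refine ⟨fun x => continuous_const, fun j ω => ?_, 0, fun ω n m h => ?_⟩
    · simp only [BoundedFamily.algebraMap_apply]
      rw [← Algebra.commutes, mul_assoc, shift_mul_star_shift, mul_one]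
    · rw [BoundedFamily.algebraMap_apply, Algebra.algebraMap_eq_smul_one, matrixElement,
        inner_ket_left]
      simp [ket_apply, dist_pos.1 h]
  star_mem' := by
    rintro A ⟨hA, hA', hR⟩
    refine ⟨hA.adjoint hR, fun j ω => ?_, hR.adjoint⟩
    rw [BoundedFamily.star_apply, BoundedFamily.star_apply, ← hA' j ω]
    simp only [star_mul, star_star, mul_assoc]

/-- The (reduced) crossed product C*-algebra `𝒜 = C(Ω) ⋊ ℤ^d` of covariant and local families:
the completion of `𝒜₀` in the norm `sup_ω ‖A_ω‖`. -/
def covariantAlgebra : StarSubalgebra ℂ (BoundedFamily Ω d) :=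
  (finiteRangeAlgebra Ω d).topologicalClosure

end Algebra

variable {Ω : Type*} {d : ℕ}

/-- The trace `𝒯(A) = 𝐄 ⟨0|A_ω|0⟩`. -/
def trace [MeasurableSpace Ω] (P : Measure Ω) (A : BoundedFamily Ω d) : ℂ :=
  ∫ ω, matrixElement (A ω) 0 0 ∂P

/-- The transfer operator built from `V` and `T` at energy `E`, a `2 × 2` matrix with operator
entries. -/
def transferOperator (V T : BoundedFamily Ω d) (E : ℝ) :
    Matrix (Fin 2) (Fin 2) (BoundedFamily Ω d) :=
  !![((E : ℂ) • 1 - V) * Ring.inverse T, -star T; Ring.inverse T, 0]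

/-- The product `ℳ_N^E ⋯ ℳ_1^E` of transfer operators. -/
def transferProduct (V T : ℕ → BoundedFamily Ω d) (E : ℝ) :
    ℕ → Matrix (Fin 2) (Fin 2) (BoundedFamily Ω d)
  | 0 => 1
  | n + 1 => transferOperator (V (n + 1)) (T (n + 1)) E * transferProduct V T E n

open Matrix in
/-- `Φ_N^E = ℳ_N^E ⋯ ℳ_1^E (1, 0)ᵗ`, a column with two operator entries. -/
def lagrangianFrame (V T : ℕ → BoundedFamily Ω d) (N : ℕ) (E : ℝ) : Fin 2 → BoundedFamily Ω d :=
  transferProduct V T E N *ᵥ ![1, 0]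

open Matrix in
/-- `(1, i)ᵗ^* Φ_N^E`, the numerator of the Prüfer phase. -/
def pruferNumerator (V T : ℕ → BoundedFamily Ω d) (N : ℕ) (E : ℝ) : BoundedFamily Ω d :=
  star ![1, Complex.I • 1] ⬝ᵥ lagrangianFrame V T N E

open Matrix in
/-- `(1, -i)ᵗ^* Φ_N^E`, the denominator of the Prüfer phase. -/
def pruferDenominator (V T : ℕ → BoundedFamily Ω d) (N : ℕ) (E : ℝ) : BoundedFamily Ω d :=
  star ![1, -Complex.I • 1] ⬝ᵥ lagrangianFrame V T N E

/-- The Prüfer phase `U_N^E = [(1, i)ᵗ^* Φ_N^E] [(1, -i)ᵗ^* Φ_N^E]⁻¹`. -/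
def pruferPhase (V T : ℕ → BoundedFamily Ω d) (N : ℕ) (E : ℝ) : BoundedFamily Ω d :=
  pruferNumerator V T N E * Ring.inverse (pruferDenominator V T N E)

/-- The phase velocity operator `S_N^E = (1 / (i N)) (U_N^E)^* ∂_E U_N^E`, the derivative being
taken in norm. -/
def phaseVelocity (V T : ℕ → BoundedFamily Ω d) (N : ℕ) (E : ℝ) : BoundedFamily Ω d :=
  (1 / (Complex.I * (N : ℂ))) • (star (pruferPhase V T N E) * deriv (pruferPhase V T N) E)

end Prufer

end

/-! ### Contour integration on a half plane -/

noncomputable section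

/-! Let φ, ψ be the entries of the frame after N steps and put D = φ + iψ, A = φ - iψ, so that the
phase is U = A D⁻¹. At real energies the frame is isotropic, φ*ψ = ψ*φ (`star_frame_fst_mul_snd`).
Hence A*A = D*D, and U is unitary as soon as A and D are invertible. Invertibility holds even on
closed half planes, for D when Im z ≥ 0 and for A when Im z ≤ 0: in `isUnit_frame_add_accretive`
each step is removed by a Schur complement, which keeps a coefficient strictly accretive. Positivity
comes from U*U' = (D⁻¹)*(A*A' - D*D')D⁻¹: the middle factor is 2i times the Wronskian of the frame
with its energy derivative, and each step adds a square to that Wronskian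
(`exists_wronskian_eq_star_mul_self`).

For the integral, cyclicity of the trace (`BoundedFamily.trace_mul_comm`) turns 𝒯(U*U') into
𝒯(A⁻¹A') - 𝒯(D⁻¹D'). Each logarithmic derivative is holomorphic on its half plane and, by
homogeneity in the energy, its trace equals N/z + O(z⁻²) at infinity. Subtracting N/(z - i),
respectively N/(z + i), whose pole lies in the opposite half plane, leaves a function whose integral
over ℝ vanishes by Cauchy's theorem. What remains of the integrand is (iN)⁻¹(N/(E - i) - N/(E + i))
= 2/(1 + E²), with integral 2π. -/

open Filter Asymptotics Bornology in
/-- A function that is holomorphic on the closed upper half plane and decays quadratically at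
infinity is integrable over the real line, with vanishing integral. -/
theorem Complex.integrable_and_integral_eq_zero_of_isBigO {h : ℂ → ℂ}
    (hd : ∀ z : ℂ, 0 ≤ z.im → DifferentiableAt ℂ h z)
    (hO : h =O[cobounded ℂ] fun z => (z ^ 2)⁻¹) :
    Integrable (fun x : ℝ => h x) ∧ ∫ x : ℝ, h x = 0 := by
  obtain ⟨C, hC, hO⟩ := hO.exists_pos
  obtain ⟨r, -, hr⟩ := (hasBasis_cobounded_norm.eventually_iff).1 hO.bound
  have hb : ∀ (R : ℝ) (z : ℂ), max r 1 ≤ R → R ≤ ‖z‖ → ‖h z‖ ≤ C / R ^ 2 := by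
    intro R z hR hz
    have hR1 : 1 ≤ R := (le_max_right _ _).trans hR
    refine (hr (((le_max_left _ _).trans hR).trans hz)).trans ?_
    rw [norm_inv, norm_pow, div_eq_mul_inv]
    gcongr
  have hcont : Continuous fun x : ℝ => h x := continuous_iff_continuousAt.2 fun x =>
    ((hd x (by simp)).continuousAt).comp Complex.continuous_ofReal.continuousAt
  have hint : Integrable fun x : ℝ => h x := by
    refine hcont.locallyIntegrable.integrable_of_isBigO_cocompact (g := fun x : ℝ => (1 + x ^ 2)⁻¹)
      (IsBigO.of_bound (2 * C) ?_) (integrable_inv_one_add_sq.integrableAtFilter _)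
    rw [← Metric.cobounded_eq_cocompact]
    refine (hasBasis_cobounded_norm.eventually_iff).2 ⟨max r 1, trivial, fun x hx => ?_⟩
    have hx1 : 1 ≤ |x| := (le_max_right _ _).trans hx
    refine (hb |x| x hx (by simp)).trans ?_
    rw [Real.norm_of_nonneg (by positivity), sq_abs, div_eq_mul_inv, mul_comm 2 C, mul_assoc]
    gcongr
    have h1 : 1 ≤ x ^ 2 := by rw [← sq_abs]; nlinarith
    rw [← div_eq_mul_inv, inv_le_comm₀ (by positivity) (by positivity), inv_div]
    linarith
  refine ⟨hint, ?_⟩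
  have hlim := intervalIntegral_tendsto_integral hint tendsto_neg_atTop_atBot tendsto_id
  refine tendsto_nhds_unique hlim (squeeze_zero_norm' (a := fun R : ℝ => 4 * C / R) ?_
    (tendsto_const_nhds.div_atTop tendsto_id))
  filter_upwards [eventually_ge_atTop (max r 1)] with R hR
  have hR1 : 1 ≤ R := (le_max_right _ _).trans hR
  -- Rectangle [-R, R] × [0, R]: the other three edges have total length 4R and stay at distance at
  -- least R from 0, so together they contribute at most 4C/R.
  have hrect := Complex.integral_boundary_rect_eq_zero_of_differentiableOn h (-R : ℝ)
    (R + R * Complex.I) (fun z hz => (hd z (by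
      have := hz.2
      simp only [Set.mem_preimage, Complex.ofReal_im, Complex.add_im, Complex.mul_im,
        Complex.ofReal_re, Complex.I_im, Complex.I_re] at this
      rw [Set.uIcc_of_le (by linarith)] at this
      exact this.1)).differentiableWithinAt)
  simp only [Complex.ofReal_re, Complex.ofReal_im, Complex.add_re, Complex.add_im, Complex.mul_re,
    Complex.mul_im, Complex.I_re, Complex.I_im, mul_zero, mul_one, zero_mul, sub_zero, add_zero,
    zero_add, Complex.ofReal_zero] at hrect
  have h1 : ‖∫ x in (-R)..R, h (x + R * Complex.I)‖ ≤ C / R ^ 2 * |R - -R| :=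
    intervalIntegral.norm_integral_le_of_norm_le_const fun x _ => hb R _ hR (by
      simpa [abs_of_nonneg (zero_le_one.trans hR1)] using Complex.abs_im_le_norm (x + R * Complex.I))
  have h2 : ‖∫ y in (0 : ℝ)..R, h (R + y * Complex.I)‖ ≤ C / R ^ 2 * |R - 0| :=
    intervalIntegral.norm_integral_le_of_norm_le_const fun y _ => hb R _ hR (by
      simpa [abs_of_nonneg (zero_le_one.trans hR1)] using Complex.abs_re_le_norm (R + y * Complex.I))
  have h3 : ‖∫ y in (0 : ℝ)..R, h ((-R : ℝ) + y * Complex.I)‖ ≤ C / R ^ 2 * |R - 0| :=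
    intervalIntegral.norm_integral_le_of_norm_le_const fun y _ => hb R _ hR (by
      simpa [abs_of_nonneg (zero_le_one.trans hR1)] using
        Complex.abs_re_le_norm ((-R : ℝ) + y * Complex.I))
  have h4 : ∫ x in (-R)..R, h x = (∫ x in (-R)..R, h (x + R * Complex.I))
      - Complex.I • (∫ y in (0 : ℝ)..R, h (R + y * Complex.I))
      + Complex.I • (∫ y in (0 : ℝ)..R, h ((-R : ℝ) + y * Complex.I)) := by
    linear_combination hrect
  simp only [id]
  rw [h4]
  refine (norm_add_le _ _).trans ((add_le_add_left (norm_sub_le _ _) _).trans ?_)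
  rw [norm_smul, norm_smul, Complex.norm_I, one_mul, one_mul]
  have e1 : |R - -R| = 2 * R := by rw [abs_of_nonneg] <;> linarith
  have e2 : |R - 0| = R := by rw [abs_of_nonneg] <;> linarith
  rw [e1] at h1
  rw [e2] at h2 h3
  calc _ ≤ C / R ^ 2 * (2 * R) + C / R ^ 2 * R + C / R ^ 2 * R := by gcongr
    _ = 4 * C / R := by field_simp; ring

/-! ### Invertibility in C*-algebras -/

section CStar

variable {B : Type*} [CStarAlgebra B]

/-- A closed star subalgebra of a C*-algebra contains the inverses of its elements. -/
theorem StarSubalgebra.ringInverse_mem (S : StarSubalgebra ℂ B) (hS : IsClosed (S : Set B)) {a : B}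
    (ha : a ∈ S) : Ring.inverse a ∈ S := by
  by_cases hu : IsUnit a
  · have := hS
    -- Spectral permanence: an element of `S` invertible in `B` is invertible in `S`.
    obtain ⟨u, hu'⟩ := (StarSubalgebra.coe_isUnit (S := S) (a := ⟨a, ha⟩)).1 hu
    have h1 : a * ((↑u⁻¹ : S) : B) = 1 := by
      have := congrArg (Subtype.val) u.mul_inv
      rw [hu'] at this
      exact this
    rw [← mul_one (Ring.inverse a), ← h1, Ring.inverse_mul_cancel_left _ _ hu]
    exact SetLike.coe_mem _
  · rw [Ring.inverse_non_unit _ hu]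
    exact zero_mem S

/-- The derivative of a path in a closed star subalgebra stays in it. -/
theorem StarSubalgebra.deriv_mem {𝕜 : Type*} [RCLike 𝕜] [NormedSpace 𝕜 B] [Module 𝕜 ℂ]
    [IsScalarTower 𝕜 ℂ B] (S : StarSubalgebra ℂ B)
    (hS : IsClosed (S : Set B)) {f : 𝕜 → B} (hf : ∀ t, f t ∈ S) (t : 𝕜) : deriv f t ∈ S := by
  -- Difference quotients are linear combinations of values, so their limit lies in the closed span.
  have h := range_deriv_subset_closure_span_image f dense_univ ⟨t, rfl⟩
  have hle : Submodule.span 𝕜 (f '' Set.univ) ≤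
      (Subalgebra.toSubmodule S.toSubalgebra).restrictScalars 𝕜 :=
    Submodule.span_le.2 (by rintro _ ⟨s, -, rfl⟩; exact hf s)
  exact closure_minimal (show (Submodule.span 𝕜 (f '' Set.univ) : Set B) ⊆ (S : Set B) from hle) hS h

/-- The element ik is self-adjoint, so its spectrum is real and misses -i; then 1 + k = i(-i - ik)
is invertible. -/
theorem isUnit_one_add_of_star_eq_neg {k : B} (hk : star k = -k) : IsUnit (1 + k) := by
  have hsa : IsSelfAdjoint (Complex.I • k) := by
    simp [IsSelfAdjoint, star_smul, hk]
  have h : (-Complex.I) ∉ spectrum ℂ (Complex.I • k) := fun h => by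
    have := hsa.mem_spectrum_eq_re h
    simpa using congrArg Complex.im this
  rw [spectrum.notMem_iff, Algebra.algebraMap_eq_smul_one] at h
  have h2 : 1 + k = Complex.I • (-Complex.I • (1 : B) - Complex.I • k) := by
    rw [smul_sub, smul_smul, smul_smul]
    simp
  rw [h2]
  exact (isUnit_smul_iff (Units.mk0 Complex.I Complex.I_ne_zero) _).2 h

variable [PartialOrder B] [StarOrderedRing B]

theorem IsStrictlyPositive.conjugate {p : B} (hp : IsStrictlyPositive p) {c : B} (hc : IsUnit c) :
    IsStrictlyPositive (c * p * star c) :=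
  IsStrictlyPositive.iff_of_unital.2
    ⟨star_right_conjugate_nonneg hp.nonneg c, (hc.mul hp.isUnit).mul hc.star⟩

/-- Strictly accretive elements of a C*-algebra are invertible. -/
theorem isUnit_of_isStrictlyPositive_add_star {a : B} (h : IsStrictlyPositive (a + star a)) :
    IsUnit a := by
  set s := CFC.sqrt (a + star a) with hs
  have hsu : IsUnit s := CFC.isUnit_sqrt_iff_isStrictlyPositive.2 h
  have hss : s * s = a + star a := CFC.sqrt_mul_sqrt_self _ h.nonneg
  have hsa : star s = s := (CFC.sqrt_nonneg (a + star a)).isSelfAdjoint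
  have hra : star (Ring.inverse s) = Ring.inverse s := by rw [← Ring.inverse_star, hsa]
  have hk := isUnit_one_add_of_star_eq_neg
    (k := Ring.inverse s * (a - star a) * Ring.inverse s) (by
      simp only [star_mul, star_sub, star_star, hra]; noncomm_ring)
  -- Split 2a into a + a* = s² and the skew part a - a*; factoring out s on both sides normalises
  -- the first to 1 and keeps the second skew.
  have h2 : (2 : ℂ) • a = s * (1 + Ring.inverse s * (a - star a) * Ring.inverse s) * s := by
    have e : s * (1 + Ring.inverse s * (a - star a) * Ring.inverse s) * s
        = s * s + (s * Ring.inverse s) * (a - star a) * (Ring.inverse s * s) := by noncomm_ring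
    rw [e, Ring.mul_inverse_cancel _ hsu, Ring.inverse_mul_cancel _ hsu, hss, two_smul]
    noncomm_ring
  have h3 : IsUnit ((2 : ℂ) • a) := h2 ▸ (hsu.mul hk).mul hsu
  exact (isUnit_smul_iff (Units.mk0 (2 : ℂ) two_ne_zero) a).1 h3

end CStar

namespace Prufer

/-! ### The transfer recursion and invertibility of the factors -/

section Frame

variable {B : Type*} [CStarAlgebra B]

/-- The solution `(φ_n, ψ_n)` of the transfer recursion, made homogeneous of degree `n` in the
complex energy `s` and an auxiliary parameter `w`; the case `w = 1` is the transfer recursion. -/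
def homogeneousFrame (V T : ℕ → B) (s w : ℂ) : ℕ → B × B
  | 0 => (1, 0)
  | n + 1 =>
    ((s • 1 - w • V (n + 1)) * (Ring.inverse (T (n + 1)) * (homogeneousFrame V T s w n).1)
        - w • (star (T (n + 1)) * (homogeneousFrame V T s w n).2),
      w • (Ring.inverse (T (n + 1)) * (homogeneousFrame V T s w n).1))

/-- The combination `φ_n + ε ψ_n` of the entries of the frame. -/
def pruferFactor (V T : ℕ → B) (ε s w : ℂ) (n : ℕ) : B :=
  (homogeneousFrame V T s w n).1 + ε • (homogeneousFrame V T s w n).2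

variable {V T : ℕ → B}

/-- Every step is homogeneous of degree one in (s, w). This makes z = ∞ accessible as the point w =
0 with s = 1. -/
theorem homogeneousFrame_mul (c s w : ℂ) (n : ℕ) :
    homogeneousFrame V T (c * s) (c * w) n = c ^ n • homogeneousFrame V T s w n := by
  induction n with
  | zero => simp [homogeneousFrame]
  | succ n ih =>
    simp only [homogeneousFrame, ih, Prod.smul_fst, Prod.smul_snd, Prod.smul_mk, Prod.mk.injEq]
    constructor
    · simp only [mul_smul_comm, sub_mul, smul_mul_assoc, smul_sub, smul_smul]
      congr 2 <;> ring_nf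
    · simp only [mul_smul_comm, smul_smul]
      ring_nf

theorem pruferFactor_eq_pow_smul (ε : ℂ) (n : ℕ) {z : ℂ} (hz : z ≠ 0) :
    pruferFactor V T ε z 1 n = z ^ n • pruferFactor V T ε 1 z⁻¹ n := by
  have h := homogeneousFrame_mul (V := V) (T := T) z 1 z⁻¹ n
  rw [mul_one, mul_inv_cancel₀ hz] at h
  rw [pruferFactor, h, pruferFactor, Prod.smul_fst, Prod.smul_snd, smul_add, smul_comm ε]

theorem differentiable_homogeneousFrame {s w : ℂ → ℂ} (hs : Differentiable ℂ s)
    (hw : Differentiable ℂ w) (n : ℕ) :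
    (Differentiable ℂ fun z => (homogeneousFrame V T (s z) (w z) n).1) ∧
      Differentiable ℂ fun z => (homogeneousFrame V T (s z) (w z) n).2 := by
  induction n with
  | zero => exact ⟨differentiable_const _, differentiable_const _⟩
  | succ n ih =>
    obtain ⟨h1, h2⟩ := ih
    simp only [homogeneousFrame]
    exact ⟨by fun_prop, by fun_prop⟩

theorem differentiable_pruferFactor (ε : ℂ) {s w : ℂ → ℂ} (hs : Differentiable ℂ s)
    (hw : Differentiable ℂ w) (n : ℕ) :
    Differentiable ℂ fun z => pruferFactor V T ε (s z) (w z) n :=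
  (differentiable_homogeneousFrame hs hw n).1.add
    ((differentiable_homogeneousFrame hs hw n).2.const_smul ε)

theorem homogeneousFrame_mem (S : StarSubalgebra ℂ B) (hS : IsClosed (S : Set B))
    (hV : ∀ n, 1 ≤ n → V n ∈ S) (hT : ∀ n, 1 ≤ n → T n ∈ S) (s w : ℂ) (n : ℕ) :
    (homogeneousFrame V T s w n).1 ∈ S ∧ (homogeneousFrame V T s w n).2 ∈ S := by
  induction n with
  | zero => exact ⟨one_mem S, zero_mem S⟩
  | succ n ih =>
    have h := mul_mem (S.ringInverse_mem hS (hT (n + 1) (by omega))) ih.1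
    exact ⟨sub_mem (mul_mem (sub_mem (SMulMemClass.smul_mem s (one_mem S))
      (SMulMemClass.smul_mem w (hV (n + 1) (by omega)))) h)
      (SMulMemClass.smul_mem w (mul_mem (star_mem (hT (n + 1) (by omega))) ih.2)),
      SMulMemClass.smul_mem w h⟩

theorem pruferFactor_mem (S : StarSubalgebra ℂ B) (hS : IsClosed (S : Set B))
    (hV : ∀ n, 1 ≤ n → V n ∈ S) (hT : ∀ n, 1 ≤ n → T n ∈ S) (ε s w : ℂ) (n : ℕ) :
    pruferFactor V T ε s w n ∈ S :=
  add_mem (homogeneousFrame_mem S hS hV hT s w n).1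
    (SMulMemClass.smul_mem ε (homogeneousFrame_mem S hS hV hT s w n).2)

/-- At w = 0 the frame is (T_n⁻¹⋯T_1⁻¹, 0), and this product is the coefficient of zⁿ in φ_n + εψ_n.
-/
theorem isUnit_pruferFactor_one_zero (hTinv : ∀ n, 1 ≤ n → IsUnit (T n)) (ε : ℂ) (n : ℕ) :
    IsUnit (pruferFactor V T ε 1 0 n) := by
  have h : IsUnit (homogeneousFrame V T 1 0 n).1 ∧ (homogeneousFrame V T 1 0 n).2 = 0 := by
    induction n with
    | zero => exact ⟨isUnit_one, rfl⟩
    | succ n ih =>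
      simp only [homogeneousFrame, zero_smul, sub_zero, one_smul, one_mul, and_true]
      exact (hTinv (n + 1) (by omega)).ringInverse.mul ih.1
  rw [pruferFactor, h.2, smul_zero, add_zero]
  exact h.1

/-- Invertibility of `φ_n + ε a ψ_n` for strictly accretive `a`, at energies in the closed half
plane selected by `ε = ± i`. The induction replaces `a` by a Schur complement. -/
theorem isUnit_frame_add_accretive [PartialOrder B] [StarOrderedRing B]
    (hVsa : ∀ n, 1 ≤ n → IsSelfAdjoint (V n))
    (hTinv : ∀ n, 1 ≤ n → IsUnit (T n)) {ε z : ℂ} (hε : ε * ε = -1) (hε' : star ε = -ε)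
    (hz : (ε * z).re ≤ 0) (n : ℕ) : ∀ a : B, IsStrictlyPositive (a + star a) →
      IsUnit ((homogeneousFrame V T z 1 n).1 + ε • (a * (homogeneousFrame V T z 1 n).2)) := by
  have hε0 : ε ≠ 0 := by rintro rfl; simp at hε
  induction n with
  | zero => intro a _; simp [homogeneousFrame]
  | succ n ih =>
    intro a ha
    have hT := hTinv (n + 1) (by omega)
    set W := Ring.inverse (T (n + 1)) with hW
    set c : B := a - ε • (z • 1 - V (n + 1)) with hc
    -- As ε is imaginary and V self-adjoint, V drops out; the energy contributes -2 Re(εz),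
    -- nonnegative on the chosen half plane.
    have hcc : c + star c = a + star a + (-(2 * (ε * z).re) : ℝ) • 1 := by
      have hre : ((-(2 * (ε * z).re) : ℝ) : ℂ) = -(ε * z) + ε * star z := by
        have h := Complex.add_conj (ε * z)
        rw [map_mul, ← Complex.star_def, hε'] at h
        push_cast at h ⊢
        linear_combination h
      rw [← Complex.coe_smul, hre, hc]
      simp only [star_sub, star_smul, (hVsa (n + 1) (by omega)).star_eq, star_one, hε']
      simp only [smul_sub, smul_smul, neg_smul, add_smul, neg_mul]
      abel
    have hcp : IsStrictlyPositive (c + star c) := by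
      rw [hcc]
      exact ha.add_nonneg (smul_nonneg (by linarith) zero_le_one)
    have hcu := isUnit_of_isStrictlyPositive_add_star hcp
    -- The new coefficient T c⁻¹ T* is again strictly accretive, because c⁻¹ + (c⁻¹)* = c⁻¹(c +
    -- c*)(c⁻¹)*.
    have hstep := ih (T (n + 1) * Ring.inverse c * star (T (n + 1))) (by
      have e : T (n + 1) * Ring.inverse c * star (T (n + 1))
          + star (T (n + 1) * Ring.inverse c * star (T (n + 1)))
          = (T (n + 1) * Ring.inverse c) * (c + star c) * star (T (n + 1) * Ring.inverse c) := by
        have h1 : Ring.inverse c * c = 1 := Ring.inverse_mul_cancel _ hcu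
        have h2 : star c * star (Ring.inverse c) = 1 := by rw [← star_mul, h1, star_one]
        simp only [star_mul, star_star, mul_add, add_mul, mul_assoc]
        rw [← mul_assoc (Ring.inverse c) c, h1, one_mul, ← mul_assoc (star c), h2, one_mul, add_comm]
      rw [e]
      exact hcp.conjugate (hT.mul hcu.ringInverse))
    -- By ε² = -1, (z - V) + εa = εc. Pulling εcT⁻¹ out on the left leaves the previous frame with
    -- coefficient T c⁻¹ T*.
    have hfac : (homogeneousFrame V T z 1 (n + 1)).1
          + ε • (a * (homogeneousFrame V T z 1 (n + 1)).2)
        = (ε • (c * W)) * ((homogeneousFrame V T z 1 n).1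
          + ε • (T (n + 1) * Ring.inverse c * star (T (n + 1)) * (homogeneousFrame V T z 1 n).2)) := by
      have h1 : W * T (n + 1) = 1 := Ring.inverse_mul_cancel _ hT
      have h2 : c * Ring.inverse c = 1 := Ring.mul_inverse_cancel _ hcu
      have e1 : c * W * (T (n + 1) * Ring.inverse c * star (T (n + 1))
          * (homogeneousFrame V T z 1 n).2)
          = star (T (n + 1)) * (homogeneousFrame V T z 1 n).2 := by
        calc _ = c * (W * T (n + 1)) * Ring.inverse c
              * (star (T (n + 1)) * (homogeneousFrame V T z 1 n).2) := by noncomm_ring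
          _ = _ := by rw [h1, mul_one, h2, one_mul]
      rw [mul_add, smul_mul_smul_comm, e1, hε]
      simp only [homogeneousFrame, ← hW, hc, one_smul, smul_mul_assoc, sub_mul, smul_sub, smul_smul,
        hε, mul_assoc, neg_smul]
      rw [← mul_assoc ε ε, hε]
      simp only [neg_smul, neg_mul, one_mul, mul_assoc]
      abel
    rw [hfac]
    exact ((isUnit_smul_iff (Units.mk0 ε hε0) _).2 (hcu.mul hT.ringInverse)).mul hstep

/-- The case a = 1; general accretive a is needed only to make the induction close. -/
theorem isUnit_pruferFactor (hVsa : ∀ n, 1 ≤ n → IsSelfAdjoint (V n))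
    (hTinv : ∀ n, 1 ≤ n → IsUnit (T n)) {ε z : ℂ} (hε : ε * ε = -1) (hε' : star ε = -ε)
    (hz : (ε * z).re ≤ 0) (n : ℕ) : IsUnit (pruferFactor V T ε z 1 n) := by
  let _ := CStarAlgebra.spectralOrder B
  have _ := CStarAlgebra.spectralOrderedRing B
  have h := isUnit_frame_add_accretive hVsa hTinv hε hε' hz n 1
    (IsStrictlyPositive.iff_of_unital.2 ⟨by rw [star_one]; exact add_nonneg zero_le_one zero_le_one, by
      rw [star_one, one_add_one_eq_two]
      rw [← map_ofNat (algebraMap ℂ B) 2]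
      exact (Units.mk0 (2 : ℂ) two_ne_zero).isUnit.map (algebraMap ℂ B)⟩)
  rwa [one_mul] at h

/-- Transfer steps at real energy preserve the symplectic form: the term with E - V is symmetric and
cancels, while T* against T⁻¹ reproduces the previous step. -/
theorem star_frame_fst_mul_snd (hVsa : ∀ n, 1 ≤ n → IsSelfAdjoint (V n))
    (hTinv : ∀ n, 1 ≤ n → IsUnit (T n)) (E : ℝ) (n : ℕ) :
    star (homogeneousFrame V T E 1 n).1 * (homogeneousFrame V T E 1 n).2
      = star (homogeneousFrame V T E 1 n).2 * (homogeneousFrame V T E 1 n).1 := by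
  induction n with
  | zero => simp [homogeneousFrame]
  | succ n ih =>
    have hT : T (n + 1) * Ring.inverse (T (n + 1)) = 1 :=
      Ring.mul_inverse_cancel _ (hTinv (n + 1) (by omega))
    have hT' : star (Ring.inverse (T (n + 1))) * star (T (n + 1)) = 1 := by
      rw [← star_mul, hT, star_one]
    have hr : star (E : ℂ) = E := Complex.conj_ofReal E
    simp only [homogeneousFrame, one_smul, star_mul, star_sub, star_smul, star_star, star_one, hr,
      (hVsa (n + 1) (by omega)).star_eq]
    set φ := (homogeneousFrame V T E 1 n).1
    set ψ := (homogeneousFrame V T E 1 n).2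
    set W := Ring.inverse (T (n + 1))
    have e1 : star ψ * T (n + 1) * (W * φ) = star ψ * φ := by
      rw [mul_assoc, ← mul_assoc (T (n + 1)), hT, one_mul]
    have e2 : star φ * star W * (star (T (n + 1)) * ψ) = star φ * ψ := by
      rw [mul_assoc, ← mul_assoc (star W), hT', one_mul]
    rw [sub_mul, mul_sub (star φ * star W) (_ * (W * φ)), e1, e2, ih, mul_assoc (star φ * star W)]

end Frame

/-! ### Unitarity of the phase and positivity of the Wronskian -/

section Phase

variable {B : Type*} [CStarAlgebra B]

/-- The cross terms are ε(φ*ψ - ψ*φ) and vanish by isotropy. The result does not see the sign of ε,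
so A*A = D*D. -/
theorem star_mul_self_of_isotropic {φ ψ : B} (h : star φ * ψ = star ψ * φ) {ε : ℂ}
    (hε : ε * ε = -1) (hε' : star ε = -ε) :
    star (φ + ε • ψ) * (φ + ε • ψ) = star φ * φ + star ψ * ψ := by
  have e : star (φ + ε • ψ) * (φ + ε • ψ)
      = star φ * φ - (ε * ε) • (star ψ * ψ) + ε • (star φ * ψ - star ψ * φ) := by
    simp only [star_add, star_smul, hε', add_mul, mul_add, smul_mul_assoc, mul_smul_comm, smul_add,
      smul_sub, neg_smul, neg_mul]
    module
  rw [e, h, sub_self, smul_zero, add_zero, hε, neg_one_smul, sub_neg_eq_add]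

theorem wronskian_identity (φ ψ φ' ψ' : B) :
    star (φ + (-Complex.I) • ψ) * (φ' + (-Complex.I) • ψ')
        - star (φ + Complex.I • ψ) * (φ' + Complex.I • ψ')
      = (2 * Complex.I) • (star ψ * φ' - star φ * ψ') := by
  simp only [star_add, star_smul, star_neg, Complex.star_def, Complex.conj_I, neg_neg, add_mul,
    mul_add, smul_mul_assoc, mul_smul_comm, smul_add, smul_sub, neg_smul, smul_smul, neg_mul, mul_neg]
  module

/-- The phase `φ - iψ` over `φ + iψ` of an isotropic pair is unitary. -/
theorem mul_ringInverse_mem_unitary {a b : B} (h : star a * a = star b * b) (ha : IsUnit a)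
    (hb : IsUnit b) : a * Ring.inverse b ∈ unitary B := by
  have h1 : star (a * Ring.inverse b) * (a * Ring.inverse b) = 1 := by
    have hb1 : b * Ring.inverse b = 1 := Ring.mul_inverse_cancel _ hb
    have hb2 : star (Ring.inverse b) * star b = 1 := by rw [← star_mul, hb1, star_one]
    rw [star_mul, mul_assoc, ← mul_assoc (star a), h, mul_assoc, hb1, mul_one, hb2]
  -- An isometry need not be unitary; invertibility supplies the second relation.
  obtain ⟨u, hu⟩ := ha.mul hb.ringInverse
  rw [← hu] at h1 ⊢
  have h2 : star (u : B) = ↑u⁻¹ := by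
    rw [← mul_one (star (u : B)), ← u.mul_inv, ← mul_assoc, h1, one_mul]
  exact Unitary.mem_iff.2 ⟨h1, by rw [h2, u.mul_inv]⟩

theorem star_mul_ringInverse_eq {a b : B} (h : star a * a = star b * b) (ha : IsUnit a)
    (hb : IsUnit b) : star (a * Ring.inverse b) = b * Ring.inverse a := by
  have h1 := (Unitary.mem_iff.1 (mul_ringInverse_mem_unitary h ha hb)).1
  have h2 : a * Ring.inverse b * (b * Ring.inverse a) = 1 := by
    rw [mul_assoc, Ring.inverse_mul_cancel_left _ _ hb, Ring.mul_inverse_cancel _ ha]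
  rw [← mul_one (star _), ← h2, ← mul_assoc, h1, one_mul]

theorem hasDerivAt_mul_ringInverse {𝕜 : Type*} [RCLike 𝕜] [NormedAlgebra 𝕜 B] {a b : 𝕜 → B}
    {a' b' : B} {t : 𝕜} (ha : HasDerivAt a a' t) (hb : HasDerivAt b b' t) (hu : IsUnit (b t)) :
    HasDerivAt (fun t => a t * Ring.inverse (b t)) (a' * Ring.inverse (b t)
      - a t * Ring.inverse (b t) * b' * Ring.inverse (b t)) t := by
  obtain ⟨u, hu⟩ := hu
  have h1 : HasFDerivAt Ring.inverse (-((ContinuousLinearMap.mulLeftRight 𝕜 B) ↑u⁻¹) ↑u⁻¹) (b t) := by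
    rw [← hu]; exact hasFDerivAt_ringInverse u
  have h2 := ha.mul (h1.comp_hasDerivAt t hb)
  have h3 : Ring.inverse (b t) = ↑u⁻¹ := by rw [← hu, Ring.inverse_unit]
  refine h2.congr_deriv ?_
  simp [h3, mul_assoc, sub_eq_add_neg]

variable {V T : ℕ → B}

theorem hasDerivAt_frame_fst (n : ℕ) (z : ℂ) :
    HasDerivAt (fun z => (homogeneousFrame V T z 1 n).1)
      (deriv (fun z => (homogeneousFrame V T z 1 n).1) z) z :=
  ((differentiable_homogeneousFrame differentiable_id (differentiable_const 1) n).1 z).hasDerivAt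

theorem hasDerivAt_frame_snd (n : ℕ) (z : ℂ) :
    HasDerivAt (fun z => (homogeneousFrame V T z 1 n).2)
      (deriv (fun z => (homogeneousFrame V T z 1 n).2) z) z :=
  ((differentiable_homogeneousFrame differentiable_id (differentiable_const 1) n).2 z).hasDerivAt

theorem deriv_frame_snd_succ (n : ℕ) (z : ℂ) :
    deriv (fun z => (homogeneousFrame V T z 1 (n + 1)).2) z
      = Ring.inverse (T (n + 1)) * deriv (fun z => (homogeneousFrame V T z 1 n).1) z := by
  simp only [homogeneousFrame, one_smul]
  exact ((hasDerivAt_frame_fst (V := V) (T := T) n z).const_mul (Ring.inverse (T (n + 1)))).deriv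

theorem deriv_frame_fst_succ (n : ℕ) (z : ℂ) :
    deriv (fun z => (homogeneousFrame V T z 1 (n + 1)).1) z
      = Ring.inverse (T (n + 1)) * (homogeneousFrame V T z 1 n).1
        + (z • 1 - V (n + 1)) * (Ring.inverse (T (n + 1))
            * deriv (fun z => (homogeneousFrame V T z 1 n).1) z)
        - star (T (n + 1)) * deriv (fun z => (homogeneousFrame V T z 1 n).2) z := by
  simp only [homogeneousFrame, one_smul]
  have h1 : HasDerivAt (fun z : ℂ => z • (1 : B) - V (n + 1)) ((1 : ℂ) • (1 : B)) z :=
    ((hasDerivAt_id z).smul_const (1 : B)).sub_const _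
  have h2 := (h1.mul ((hasDerivAt_frame_fst (V := V) (T := T) n z).const_mul (Ring.inverse (T (n + 1))))).sub
    ((hasDerivAt_frame_snd (V := V) (T := T) n z).const_mul (star (T (n + 1))))
  rw [one_smul, one_mul] at h2
  exact h2.deriv

/-- At real energies the Wronskian of the frame with its energy derivative is positive. -/
theorem exists_wronskian_eq_star_mul_self (hVsa : ∀ n, 1 ≤ n → IsSelfAdjoint (V n))
    (hTinv : ∀ n, 1 ≤ n → IsUnit (T n)) (E : ℝ) (n : ℕ) :
    ∃ b : B, star (homogeneousFrame V T E 1 n).2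
          * deriv (fun z => (homogeneousFrame V T z 1 n).1) (E : ℂ)
        - star (homogeneousFrame V T E 1 n).1
          * deriv (fun z => (homogeneousFrame V T z 1 n).2) (E : ℂ) = star b * b := by
  let _ := CStarAlgebra.spectralOrder B
  have _ := CStarAlgebra.spectralOrderedRing B
  refine CStarAlgebra.nonneg_iff_eq_star_mul_self.1 ?_
  induction n with
  | zero => simp [homogeneousFrame]
  | succ n ih =>
    rw [deriv_frame_fst_succ, deriv_frame_snd_succ]
    have hT : T (n + 1) * Ring.inverse (T (n + 1)) = 1 :=
      Ring.mul_inverse_cancel _ (hTinv (n + 1) (by omega))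
    have hT' : star (Ring.inverse (T (n + 1))) * star (T (n + 1)) = 1 := by
      rw [← star_mul, hT, star_one]
    have hr : star (E : ℂ) = E := Complex.conj_ofReal E
    simp only [homogeneousFrame, one_smul, star_mul, star_sub, star_smul, star_star, star_one, hr,
      (hVsa (n + 1) (by omega)).star_eq]
    set φ := (homogeneousFrame V T E 1 n).1
    set ψ := (homogeneousFrame V T E 1 n).2
    set φ' := deriv (fun z => (homogeneousFrame V T z 1 n).1) (E : ℂ)
    set ψ' := deriv (fun z => (homogeneousFrame V T z 1 n).2) (E : ℂ)
    set W := Ring.inverse (T (n + 1))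
    generalize (E : ℂ) • (1 : B) - V (n + 1) = X
    have e1 : star ψ * T (n + 1) * (W * φ') = star ψ * φ' := by
      rw [mul_assoc, ← mul_assoc (T (n + 1)), hT, one_mul]
    have e2 : star φ * star W * (star (T (n + 1)) * ψ') = star φ * ψ' := by
      rw [mul_assoc, ← mul_assoc (star W), hT', one_mul]
    -- The terms in X cancel and those in T rebuild the previous Wronskian; the square of T⁻¹φ comes
    -- from differentiating E - V.
    have e3 : star φ * star W * (W * φ + X * (W * φ') - star (T (n + 1)) * ψ')
        - (star φ * star W * X - star ψ * T (n + 1)) * (W * φ')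
        = star (W * φ) * (W * φ) + (star ψ * φ' - star φ * ψ') := by
      rw [mul_sub (star φ * star W), sub_mul _ _ (W * φ'), e1, e2, star_mul]
      noncomm_ring
    rw [e3]
    exact add_nonneg (star_mul_self_nonneg _) ih

end Phase

/-! ### The trace per unit volume and its cyclicity -/

section Trace

variable {Ω : Type*} {d : ℕ}

theorem norm_ket (n : Fin d → ℤ) : ‖(ket n : LatticeSpace d)‖ = 1 := by
  simp [ket, lp.norm_single]

theorem norm_matrixElement_le (A : LatticeOp d) (n m : Fin d → ℤ) :
    ‖matrixElement A n m‖ ≤ ‖A‖ := by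
  refine (norm_inner_le_norm _ _).trans ?_
  rw [norm_ket, one_mul]
  simpa [norm_ket] using A.le_opNorm (ket m)

theorem sum_norm_sq_matrixElement_le (A : LatticeOp d) (m : Fin d → ℤ)
    (F : Finset (Fin d → ℤ)) : ∑ n ∈ F, ‖matrixElement A n m‖ ^ 2 ≤ ‖A‖ ^ 2 := by
  have h := lp.sum_rpow_le_norm_rpow (p := 2) (by norm_num) (A (ket m)) F
  simp only [ENNReal.toReal_ofNat, Real.rpow_two] at h
  simp only [matrixElement, inner_ket_left]
  refine h.trans ?_
  gcongr
  simpa [norm_ket] using A.le_opNorm (ket m)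

theorem hasSum_matrixElement_mul (A B : LatticeOp d) (n m : Fin d → ℤ) :
    HasSum (fun k => matrixElement A n k * matrixElement B k m) (matrixElement (A * B) n m) := by
  have h := ((BoundedFamily.hasSum_ket (B (ket m))).mapL A).mapL (innerSL ℂ (ket n))
  simpa only [map_smul, innerSL_apply_apply, smul_eq_mul, mul_comm, matrixElement, inner_ket_left,
    mul_apply_eq_comp, inner_smul_right] using h

theorem matrixElement_shift_conj (A : LatticeOp d) (j : Fin d) (n m : Fin d → ℤ) :
    matrixElement (shift j * A * star (shift j)) (n + Pi.single j 1) (m + Pi.single j 1)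
      = matrixElement A n m := by
  have h : star (shift j) (ket (m + Pi.single j 1)) = (ket m : LatticeSpace d) := by
    ext k
    rw [star_shift_apply, ket_apply, ket_apply]
    simp
  simp only [matrixElement, inner_ket_left, mul_apply_eq_comp, h, shift_apply,
    add_sub_cancel_right]

namespace BoundedFamily

theorem sub_apply (A B : BoundedFamily Ω d) (ω : Ω) : (A - B) ω = A ω - B ω := rfl

theorem continuous_eval (ω : Ω) : Continuous fun A : BoundedFamily Ω d => A ω :=
  (LipschitzWith.of_dist_le_mul (K := 1) fun A B => by
    rw [dist_eq_norm, dist_eq_norm, NNReal.coe_one, one_mul]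
    exact (A - B).norm_apply_le ω).continuous

theorem trace_one [MeasurableSpace Ω] (P : Measure Ω) [IsProbabilityMeasure P] :
    trace P (1 : BoundedFamily Ω d) = 1 := by
  have h : ∀ ω : Ω, matrixElement ((1 : BoundedFamily Ω d) ω) 0 0 = 1 := fun ω => by
    change ⟪ket 0, (ket 0 : LatticeSpace d)⟫_ℂ = 1
    rw [inner_ket_left, ket_apply, if_pos rfl]
  simp [trace, h]

theorem matrixElement_vadd [AddAction (Fin d → ℤ) Ω] {A : BoundedFamily Ω d} (hA : A.IsCovariant)
    (v n m : Fin d → ℤ) (ω : Ω) :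
    matrixElement (A (v +ᵥ ω)) (n + v) (m + v) = matrixElement (A ω) n m := by
  -- Covariance is given for generators only; the translations satisfying the formula form a
  -- subgroup, hence all of ℤ^d.
  let H : AddSubgroup (Fin d → ℤ) :=
    { carrier := {v | ∀ (n m : Fin d → ℤ) (ω : Ω),
        matrixElement (A (v +ᵥ ω)) (n + v) (m + v) = matrixElement (A ω) n m}
      zero_mem' := fun n m ω => by
        change matrixElement (A ((0 : Fin d → ℤ) +ᵥ ω)) (n + 0) (m + 0) = _
        rw [zero_vadd, add_zero, add_zero]
      add_mem' := fun {v w} hv hw n m ω => by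
        rw [add_vadd, add_comm v w, ← add_assoc, ← add_assoc, hv, hw]
      neg_mem' := fun {v} hv n m ω => by
        have h := hv (n + -v) (m + -v) (-v +ᵥ ω)
        rw [vadd_vadd, add_neg_cancel, zero_vadd, neg_add_cancel_right, neg_add_cancel_right] at h
        exact h.symm }
  have hj : ∀ j : Fin d, Pi.single j 1 ∈ H := fun j n m ω => by
    rw [← hA j ω, matrixElement_shift_conj]
  have hv : v ∈ H := by
    have e : v = ∑ j, v j • (Pi.single j 1 : Fin d → ℤ) := by
      ext i
      simp [Finset.sum_apply, Pi.single_apply]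
    rw [e]
    exact sum_mem fun j _ => zsmul_mem (hj j) _
  exact hv n m ω

theorem IsStronglyContinuous.continuous_matrixElement [TopologicalSpace Ω]
    {A : BoundedFamily Ω d} (hA : A.IsStronglyContinuous) (n m : Fin d → ℤ) :
    Continuous fun ω => matrixElement (A ω) n m :=
  continuous_const.inner (hA (ket m))

variable [TopologicalSpace Ω] [MeasurableSpace Ω] [BorelSpace Ω] (P : Measure Ω)

theorem IsStronglyContinuous.integrable_matrixElement [IsFiniteMeasure P]
    {A : BoundedFamily Ω d} (hA : A.IsStronglyContinuous) (n m : Fin d → ℤ) :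
    Integrable (fun ω => matrixElement (A ω) n m) P :=
  Integrable.of_bound (hA.continuous_matrixElement n m).aestronglyMeasurable ‖A‖
    (Filter.Eventually.of_forall fun ω => (norm_matrixElement_le _ n m).trans (A.norm_apply_le ω))

variable [IsProbabilityMeasure P]

/-- Expanding the product over the basis, sum and integral may be exchanged because a row of A_ω and
a column of B_ω are square summable, uniformly in ω. -/
theorem hasSum_trace_mul {A B : BoundedFamily Ω d} (hA : A.IsStronglyContinuous)
    (hB : B.IsStronglyContinuous) :
    HasSum (fun k : Fin d → ℤ => ∫ ω, matrixElement (A ω) 0 k * matrixElement (B ω) k 0 ∂P)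
      (trace P (A * B)) := by
  have hint : ∀ k, Integrable
      (fun ω => matrixElement (A ω) 0 k * matrixElement (B ω) k 0) P := fun k =>
    (hB.integrable_matrixElement P k 0).bdd_mul (c := ‖A‖)
      (hA.continuous_matrixElement 0 k).aestronglyMeasurable
      (Filter.Eventually.of_forall fun ω => (norm_matrixElement_le _ 0 k).trans (A.norm_apply_le ω))
  have hsum : Summable fun k => ∫ ω, ‖matrixElement (A ω) 0 k * matrixElement (B ω) k 0‖ ∂P := by
    refine summable_of_sum_le (c := ‖A‖ ^ 2 + ‖B‖ ^ 2)
      (fun k => integral_nonneg fun ω => norm_nonneg _) fun F => ?_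
    rw [← integral_finsetSum F fun k _ => (hint k).norm]
    have hle : ∀ ω, ∑ k ∈ F, ‖matrixElement (A ω) 0 k * matrixElement (B ω) k 0‖
        ≤ ‖A‖ ^ 2 + ‖B‖ ^ 2 := fun ω => by
      have h1 : ∑ k ∈ F, ‖matrixElement (A ω) 0 k‖ ^ 2 ≤ ‖A‖ ^ 2 := by
        have h := sum_norm_sq_matrixElement_le (star (A ω)) 0 F
        simp only [matrixElement_star, norm_star] at h
        exact h.trans (by gcongr; exact (norm_star (A ω)).le.trans (A.norm_apply_le ω))
      have h2 : ∑ k ∈ F, ‖matrixElement (B ω) k 0‖ ^ 2 ≤ ‖B‖ ^ 2 :=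
        (sum_norm_sq_matrixElement_le (B ω) 0 F).trans (by gcongr; exact B.norm_apply_le ω)
      refine le_trans (Finset.sum_le_sum fun k _ => ?_)
        (Finset.sum_add_distrib.trans_le (add_le_add h1 h2))
      rw [norm_mul]
      nlinarith [sq_nonneg (‖matrixElement (A ω) 0 k‖ - ‖matrixElement (B ω) k 0‖),
        sq_nonneg ‖matrixElement (A ω) 0 k‖, sq_nonneg ‖matrixElement (B ω) k 0‖]
    calc _ ≤ ∫ _, ‖A‖ ^ 2 + ‖B‖ ^ 2 ∂P :=
          integral_mono (integrable_finsetSum F fun k _ => (hint k).norm) (integrable_const _) hle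
      _ = _ := by simp
  have h := hasSum_integral_of_summable_integral_norm hint hsum
  simp only [(hasSum_matrixElement_mul _ _ _ _).tsum_eq] at h
  exact h

/-- The trace per unit volume is tracial on covariant families. -/
theorem trace_mul_comm [AddAction (Fin d → ℤ) Ω] [ContinuousConstVAdd (Fin d → ℤ) Ω]
    [VAddInvariantMeasure (Fin d → ℤ) Ω P] {A B : BoundedFamily Ω d} (hA : A.IsStronglyContinuous)
    (hA' : A.IsCovariant) (hB : B.IsStronglyContinuous) (hB' : B.IsCovariant) :
    trace P (A * B) = trace P (B * A) := by
  -- The k-th term for AB equals the (-k)-th for BA: covariance moves ω to -k + ω, and invariance of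
  -- `P` undoes this under the integral.
  have h := (Equiv.neg (Fin d → ℤ)).hasSum_iff.2 (hasSum_trace_mul P hB hA)
  refine (hasSum_trace_mul P hA hB).unique (h.congr_fun ?_)
  intro k
  have e : ∀ ω : Ω, matrixElement (A ω) 0 k * matrixElement (B ω) k 0
      = matrixElement (B (-k +ᵥ ω)) 0 (-k) * matrixElement (A (-k +ᵥ ω)) (-k) 0 := fun ω => by
    rw [← matrixElement_vadd hA' (-k) 0 k ω, ← matrixElement_vadd hB' (-k) k 0 ω]
    simp [mul_comm]
  simp only [e, Function.comp, Equiv.neg_apply]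
  exact ((measurePreserving_vadd (-k) P).integral_comp
    (Homeomorph.vadd (-k)).measurableEmbedding
    fun ω => matrixElement (B ω) 0 (-k) * matrixElement (A ω) (-k) 0)

end BoundedFamily

/-! ### Passage from 𝒜₀ to its norm closure -/

section Closure

variable [TopologicalSpace Ω] [AddAction (Fin d → ℤ) Ω]

theorem isClosed_covariantAlgebra :
    IsClosed (covariantAlgebra Ω d : Set (BoundedFamily Ω d)) :=
  StarSubalgebra.isClosed_topologicalClosure _

theorem exists_finiteRange_norm_sub_lt {A : BoundedFamily Ω d} (hA : A ∈ covariantAlgebra Ω d)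
    {ε : ℝ} (hε : 0 < ε) : ∃ B ∈ finiteRangeAlgebra Ω d, ‖A - B‖ < ε := by
  have hA' : A ∈ closure (finiteRangeAlgebra Ω d : Set (BoundedFamily Ω d)) := hA
  obtain ⟨B, hB, h⟩ := Metric.mem_closure_iff.1 hA' ε hε
  exact ⟨B, hB, by rwa [← dist_eq_norm]⟩

/-- Finite range is lost in the closure, but strong continuity passes to limits uniform in ω; with
covariance it is all that cyclicity needs. -/
theorem isStronglyContinuous_of_mem {A : BoundedFamily Ω d} (hA : A ∈ covariantAlgebra Ω d) :
    A.IsStronglyContinuous := by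
  intro x
  refine continuous_of_uniform_approx_of_continuous fun u hu => ?_
  obtain ⟨ε, hε, hεu⟩ := Metric.mem_uniformity_dist.1 hu
  obtain ⟨B, hB, h⟩ := exists_finiteRange_norm_sub_lt hA
    (show 0 < ε / (‖x‖ + 1) from div_pos hε (by positivity))
  refine ⟨fun ω => B ω x, hB.1 x, fun ω => hεu ?_⟩
  rw [dist_eq_norm, ← _root_.sub_apply, ← BoundedFamily.sub_apply]
  rw [lt_div_iff₀ (by positivity)] at h
  calc ‖(A - B) ω x‖ ≤ ‖(A - B) ω‖ * ‖x‖ := ContinuousLinearMap.le_opNorm _ _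
    _ ≤ ‖A - B‖ * (‖x‖ + 1) :=
      mul_le_mul ((A - B).norm_apply_le ω) (by linarith) (norm_nonneg _) (norm_nonneg _)
    _ < ε := h

theorem isCovariant_of_mem {A : BoundedFamily Ω d} (hA : A ∈ covariantAlgebra Ω d) :
    A.IsCovariant := by
  intro j ω
  refine closure_minimal (t := {A : BoundedFamily Ω d |
      shift j * A ω * star (shift j) = A ((Pi.single j 1 : Fin d → ℤ) +ᵥ ω)})
    (fun B hB => hB.2.1 j ω) ?_ hA
  exact isClosed_eq ((continuous_const.mul (BoundedFamily.continuous_eval ω)).mul continuous_const)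
    (BoundedFamily.continuous_eval _)

variable [MeasurableSpace Ω] [BorelSpace Ω] (P : Measure Ω) [IsProbabilityMeasure P]

/-- The trace on the covariant algebra extends to a bounded functional on all bounded families. -/
theorem exists_continuousLinearMap_eq_trace : ∃ g : BoundedFamily Ω d →L[ℂ] ℂ,
    ∀ A ∈ covariantAlgebra Ω d, g A = trace P A := by
  let p : Submodule ℂ (BoundedFamily Ω d) :=
    Subalgebra.toSubmodule (covariantAlgebra Ω d).toSubalgebra
  have hint : ∀ A : p, Integrable (fun ω => matrixElement (A.1 ω) 0 0) P := fun A =>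
    (isStronglyContinuous_of_mem A.2).integrable_matrixElement P 0 0
  let f : p →ₗ[ℂ] ℂ :=
    { toFun := fun A => trace P A.1
      map_add' := fun A B => by
        rw [trace, trace, trace, ← integral_add (hint A) (hint B)]
        refine integral_congr_ae (Filter.Eventually.of_forall fun ω => ?_)
        exact inner_add_right _ _ _
      map_smul' := fun c A => by
        rw [trace, trace, RingHom.id_apply, ← integral_smul]
        refine integral_congr_ae (Filter.Eventually.of_forall fun ω => ?_)
        exact inner_smul_right _ _ _ }
  -- Matrix elements of an arbitrary bounded family need not be measurable, so the trace is extended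
  -- by Hahn–Banach. The extension can be composed with holomorphic maps into the whole C*-algebra.
  obtain ⟨g, hg, -⟩ := exists_extension_norm_eq p (f.mkContinuous 1 fun A => by
    have h := norm_integral_le_of_norm_le_const (μ := P) (f := fun ω => matrixElement (A.1 ω) 0 0)
      (C := ‖A.1‖) (Filter.Eventually.of_forall fun ω =>
        (norm_matrixElement_le _ 0 0).trans (A.1.norm_apply_le ω))
    rw [probReal_univ, mul_one] at h
    rw [one_mul]
    exact h)
  exact ⟨g, fun A hA => hg ⟨A, hA⟩⟩

end Closure

end Trace

/-! ### Logarithmic derivatives at complex energy -/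

section LogDeriv

open Filter Asymptotics Bornology Topology

variable {B : Type*} [CStarAlgebra B]

/-- The logarithmic derivative `D⁻¹ ∂_z D` of `D = φ_n + ε ψ_n` in the complex energy `z`. -/
def pruferLogDeriv (V T : ℕ → B) (ε : ℂ) (n : ℕ) (z : ℂ) : B :=
  Ring.inverse (pruferFactor V T ε z 1 n) * deriv (fun z => pruferFactor V T ε z 1 n) z

variable {V T : ℕ → B}

theorem differentiable_deriv {f : ℂ → B} (hf : Differentiable ℂ f) : Differentiable ℂ (deriv f) :=
  (hf.contDiff (n := 2)).differentiable_deriv_two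

theorem ringInverse_smul {c : ℂ} (hc : c ≠ 0) (a : B) :
    Ring.inverse (c • a) = c⁻¹ • Ring.inverse a := by
  have h : c • a = algebraMap ℂ B c * a := by rw [Algebra.smul_def]
  have hu : IsUnit (algebraMap ℂ B c) := (Units.mk0 c hc).isUnit.map (algebraMap ℂ B)
  have hi : Ring.inverse (algebraMap ℂ B c) = algebraMap ℂ B c⁻¹ := by
    rw [← mul_one (Ring.inverse _), ← map_one (algebraMap ℂ B), ← mul_inv_cancel₀ hc, map_mul,
      Ring.inverse_mul_cancel_left _ _ hu]
  rw [h, Ring.inverse_mul (Or.inl hu), hi, ← Algebra.commutes, Algebra.smul_def]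

/-- Differentiate zⁿF(1/z), where F is the factor as a function of w at s = 1. -/
theorem pruferLogDeriv_eq (ε : ℂ) (n : ℕ) {z : ℂ} (hz : z ≠ 0)
    (hu : IsUnit (pruferFactor V T ε 1 z⁻¹ n)) :
    pruferLogDeriv V T ε n z = ((n : ℂ) / z) • 1 - (z ^ 2)⁻¹ •
      (Ring.inverse (pruferFactor V T ε 1 z⁻¹ n)
        * deriv (fun w => pruferFactor V T ε 1 w n) z⁻¹) := by
  have h1 : (fun z => pruferFactor V T ε z 1 n)
      =ᶠ[𝓝 z] fun z => z ^ n • pruferFactor V T ε 1 z⁻¹ n := by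
    filter_upwards [isOpen_ne.mem_nhds hz] with y hy using pruferFactor_eq_pow_smul ε n hy
  have h2 : HasDerivAt (fun w => pruferFactor V T ε 1 w n)
      (deriv (fun w => pruferFactor V T ε 1 w n) z⁻¹) z⁻¹ :=
    (differentiable_pruferFactor ε (differentiable_const 1) differentiable_id n _).hasDerivAt
  have h3 := (hasDerivAt_pow n z).smul (h2.scomp z (hasDerivAt_inv hz))
  have h4 : (n : ℂ) * z ^ (n - 1) = (n / z) * z ^ n := by
    rcases n with _ | n
    · simp
    · rw [Nat.add_sub_cancel, pow_succ]
      field_simp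
  have h5 : deriv (fun z => pruferFactor V T ε z 1 n) z = _ := h1.deriv_eq.trans h3.deriv
  rw [pruferLogDeriv, h5, pruferFactor_eq_pow_smul ε n hz, ringInverse_smul (pow_ne_zero n hz), h4]
  simp only [Function.comp, smul_mul_assoc, mul_add, mul_smul_comm, smul_smul,
    Ring.inverse_mul_cancel _ hu]
  have hzn : z ^ n ≠ 0 := pow_ne_zero n hz
  rw [add_comm, sub_eq_add_neg, ← neg_smul]
  congr 2
  · field_simp
  · field_simp

theorem isBigO_pruferLogDeriv_sub (hTinv : ∀ n, 1 ≤ n → IsUnit (T n)) (g : B →L[ℂ] ℂ)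
    (hg : g 1 = 1) (ε : ℂ) (n : ℕ) :
    (fun z => g (pruferLogDeriv V T ε n z) - n / (z + ε)) =O[cobounded ℂ] fun z => (z ^ 2)⁻¹ := by
  have hd : Differentiable ℂ fun w => pruferFactor V T ε 1 w n :=
    differentiable_pruferFactor ε (differentiable_const 1) differentiable_id n
  have hu0 := isUnit_pruferFactor_one_zero (V := V) hTinv ε n
  -- This is z² times the difference, read in w = 1/z; its first term encodes n/z - n/(z + ε).
  -- Continuity at w = 0 gives the bound.
  set m : ℂ → ℂ := fun w => n * ε / (1 + ε * w)
    - g (Ring.inverse (pruferFactor V T ε 1 w n) * deriv (fun w => pruferFactor V T ε 1 w n) w)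
    with hm
  have hmc : ContinuousAt m 0 := by
    refine ContinuousAt.sub (ContinuousAt.div (by fun_prop) (by fun_prop) (by simp)) ?_
    refine g.continuous.continuousAt.comp (ContinuousAt.mul ?_
      (differentiable_deriv hd).continuous.continuousAt)
    exact ContinuousAt.comp (f := fun w => pruferFactor V T ε 1 w n) (g := Ring.inverse)
      (differentiableAt_inverse (𝕜 := ℂ) hu0).continuousAt hd.continuous.continuousAt
  have hev : ∀ᶠ w in 𝓝 (0 : ℂ), IsUnit (pruferFactor V T ε 1 w n) ∧ 1 + ε * w ≠ 0 := by
    refine (hd.continuous.continuousAt.eventually (Units.isOpen.mem_nhds hu0)).and ?_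
    have hc : ContinuousAt (fun w : ℂ => 1 + ε * w) 0 := by fun_prop
    exact hc.eventually_ne (by simp)
  have heq : (fun z => g (pruferLogDeriv V T ε n z) - n / (z + ε))
      =ᶠ[cobounded ℂ] fun z => (z ^ 2)⁻¹ * m z⁻¹ := by
    filter_upwards [tendsto_inv₀_cobounded.eventually hev, eventually_ne_cobounded (0 : ℂ)]
      with z hz hz0
    rw [pruferLogDeriv_eq ε n hz0 hz.1, map_sub, map_smul, map_smul, hg, hm]
    have hz1 : z + ε ≠ 0 := fun h => hz.2 (by rw [← mul_inv_cancel₀ hz0, ← add_mul, h, zero_mul])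
    have hz2 := hz.2
    simp only [smul_eq_mul, mul_one, mul_sub]
    have e : (z ^ 2)⁻¹ * (n * ε / (1 + ε * z⁻¹)) = n / z - n / (z + ε) := by
      have : 1 + ε * z⁻¹ = (z + ε) / z := by field_simp
      rw [this]
      field_simp
      ring
    rw [e]
    ring
  refine heq.trans_isBigO ?_
  have h1 : (fun z => m z⁻¹) =O[cobounded ℂ] fun _ => (1 : ℂ) :=
    (hmc.tendsto.comp tendsto_inv₀_cobounded).isBigO_one ℂ
  simpa using (isBigO_refl (fun z : ℂ => (z ^ 2)⁻¹) _).mul h1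

theorem differentiableAt_pruferLogDeriv {ε z : ℂ} {n : ℕ}
    (hu : IsUnit (pruferFactor V T ε z 1 n)) :
    DifferentiableAt ℂ (pruferLogDeriv V T ε n) z := by
  have hd : Differentiable ℂ fun z => pruferFactor V T ε z 1 n :=
    differentiable_pruferFactor ε differentiable_id (differentiable_const 1) n
  exact (DifferentiableAt.comp z (f := fun z => pruferFactor V T ε z 1 n) (g := Ring.inverse)
    (differentiableAt_inverse hu) (hd z)).mul (differentiable_deriv hd z)

theorem integrable_and_integral_pruferLogDeriv_sub (hVsa : ∀ n, 1 ≤ n → IsSelfAdjoint (V n))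
    (hTinv : ∀ n, 1 ≤ n → IsUnit (T n)) (g : B →L[ℂ] ℂ) (hg : g 1 = 1) {ε : ℂ}
    (hε : ε = Complex.I ∨ ε = -Complex.I) (n : ℕ) :
    Integrable (fun x : ℝ => g (pruferLogDeriv V T ε n x) - n / (x + ε)) ∧
      ∫ x : ℝ, (g (pruferLogDeriv V T ε n x) - n / (x + ε)) = 0 := by
  have hε1 : ε * ε = -1 := by rcases hε with rfl | rfl <;> simp
  have hε2 : star ε = -ε := by rcases hε with rfl | rfl <;> simp
  have hO := isBigO_pruferLogDeriv_sub (V := V) hTinv g hg ε n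
  have hd : ∀ z : ℂ, (ε * z).re ≤ 0 →
      DifferentiableAt ℂ (fun z => g (pruferLogDeriv V T ε n z) - n / (z + ε)) z := fun z hz => by
    -- The pole -ε gives ε(-ε) = 1, so it lies outside the half plane Re(εz) ≤ 0.
    have h0 : z + ε ≠ 0 := fun h => by
      rw [eq_neg_of_add_eq_zero_left h, mul_neg, hε1] at hz
      norm_num at hz
    have h1 := differentiableAt_pruferLogDeriv (isUnit_pruferFactor hVsa hTinv hε1 hε2 hz n)
    exact (g.differentiableAt.comp z h1).sub
      ((differentiableAt_const _).div (differentiableAt_id.add_const _) h0)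
  rcases hε with rfl | rfl
  · exact Complex.integrable_and_integral_eq_zero_of_isBigO
      (fun z hz => hd z (by simpa using hz)) hO
  -- For ε = -i holomorphy holds on the lower half plane; the reflection z ↦ -z reduces to the upper
  -- one and preserves integrals over ℝ.
  · have h := Complex.integrable_and_integral_eq_zero_of_isBigO
      (h := fun z => g (pruferLogDeriv V T (-Complex.I) n (-z)) - n / (-z + -Complex.I))
      (fun z hz => (hd (-z) (by simpa using hz)).comp z differentiableAt_id.neg)
      (by simpa [Function.comp_def] using hO.comp_tendsto (tendsto_neg_cobounded (E := ℂ)))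
    have h1 := h.1.comp_neg
    have h2 := h.2
    rw [← integral_neg_eq_self] at h2
    simp only [Complex.ofReal_neg, neg_neg] at h1 h2
    exact ⟨h1, h2⟩

end LogDeriv

/-! ### The phase velocity in terms of the two factors -/

section PhaseVelocity

variable {B : Type*} [CStarAlgebra B] {V T : ℕ → B}

theorem star_pruferFactor_mul_self (hVsa : ∀ n, 1 ≤ n → IsSelfAdjoint (V n))
    (hTinv : ∀ n, 1 ≤ n → IsUnit (T n)) (E : ℝ) (n : ℕ) :
    star (pruferFactor V T (-Complex.I) E 1 n) * pruferFactor V T (-Complex.I) E 1 n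
      = star (pruferFactor V T Complex.I E 1 n) * pruferFactor V T Complex.I E 1 n := by
  have h := star_frame_fst_mul_snd hVsa hTinv E n
  rw [pruferFactor, pruferFactor, star_mul_self_of_isotropic h (by simp) (by simp),
    star_mul_self_of_isotropic h (by simp) (by simp)]

theorem isUnit_pruferFactor_ofReal (hVsa : ∀ n, 1 ≤ n → IsSelfAdjoint (V n))
    (hTinv : ∀ n, 1 ≤ n → IsUnit (T n)) (E : ℝ) (n : ℕ) :
    IsUnit (pruferFactor V T Complex.I E 1 n) ∧ IsUnit (pruferFactor V T (-Complex.I) E 1 n) :=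
  ⟨isUnit_pruferFactor hVsa hTinv (by simp) (by simp) (by simp) n,
    isUnit_pruferFactor hVsa hTinv (by simp) (by simp) (by simp) n⟩

theorem hasDerivAt_pruferFactor_ofReal (ε : ℂ) (n : ℕ) (E : ℝ) :
    HasDerivAt (fun E : ℝ => pruferFactor V T ε E 1 n)
      (deriv (fun z => pruferFactor V T ε z 1 n) (E : ℂ)) E := by
  have h : HasDerivAt (fun z => pruferFactor V T ε z 1 n)
      (deriv (fun z => pruferFactor V T ε z 1 n) (E : ℂ)) (E : ℂ) :=
    (differentiable_pruferFactor ε differentiable_id (differentiable_const 1) n _).hasDerivAt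
  have h2 := h.scomp E Complex.ofRealCLM.hasDerivAt
  rw [Complex.ofRealCLM_apply, Complex.ofReal_one, one_smul] at h2
  exact h2

theorem deriv_pruferFactor (ε : ℂ) (n : ℕ) (z : ℂ) :
    deriv (fun z => pruferFactor V T ε z 1 n) z
      = deriv (fun z => (homogeneousFrame V T z 1 n).1) z
        + ε • deriv (fun z => (homogeneousFrame V T z 1 n).2) z :=
  ((hasDerivAt_frame_fst (V := V) (T := T) n z).add
    ((hasDerivAt_frame_snd (V := V) (T := T) n z).const_smul ε)).deriv

theorem hasDerivAt_pruferFactor_div (hVsa : ∀ n, 1 ≤ n → IsSelfAdjoint (V n))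
    (hTinv : ∀ n, 1 ≤ n → IsUnit (T n)) (n : ℕ) (E : ℝ) :
    HasDerivAt (fun E : ℝ => pruferFactor V T (-Complex.I) E 1 n
        * Ring.inverse (pruferFactor V T Complex.I E 1 n))
      (deriv (fun z => pruferFactor V T (-Complex.I) z 1 n) (E : ℂ)
          * Ring.inverse (pruferFactor V T Complex.I E 1 n)
        - pruferFactor V T (-Complex.I) E 1 n * Ring.inverse (pruferFactor V T Complex.I E 1 n)
          * deriv (fun z => pruferFactor V T Complex.I z 1 n) (E : ℂ)
          * Ring.inverse (pruferFactor V T Complex.I E 1 n)) E :=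
  hasDerivAt_mul_ringInverse (hasDerivAt_pruferFactor_ofReal _ n E)
    (hasDerivAt_pruferFactor_ofReal _ n E) (isUnit_pruferFactor_ofReal hVsa hTinv E n).1

/-- The operator `U^* ∂_E U` in terms of the two factors of the phase. -/
theorem star_mul_deriv_pruferFactor_div (hVsa : ∀ n, 1 ≤ n → IsSelfAdjoint (V n))
    (hTinv : ∀ n, 1 ≤ n → IsUnit (T n)) (n : ℕ) (E : ℝ) :
    star (pruferFactor V T (-Complex.I) E 1 n
          * Ring.inverse (pruferFactor V T Complex.I E 1 n))
        * deriv (fun E : ℝ => pruferFactor V T (-Complex.I) E 1 n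
          * Ring.inverse (pruferFactor V T Complex.I E 1 n)) E
      = pruferFactor V T Complex.I E 1 n * (pruferLogDeriv V T (-Complex.I) n E
          * Ring.inverse (pruferFactor V T Complex.I E 1 n))
        - deriv (fun z => pruferFactor V T Complex.I z 1 n) (E : ℂ)
          * Ring.inverse (pruferFactor V T Complex.I E 1 n) := by
  obtain ⟨hD, hA⟩ := isUnit_pruferFactor_ofReal hVsa hTinv E n
  have hs := star_pruferFactor_mul_self hVsa hTinv E n
  rw [(hasDerivAt_pruferFactor_div hVsa hTinv n E).deriv, pruferLogDeriv, mul_sub]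
  congr 1
  -- Unitarity gives U* = D A⁻¹, so this term is A⁻¹A' conjugated by D; in the other one U*U = 1 is
  -- used.
  · rw [star_mul_ringInverse_eq hs hA hD]
    simp only [mul_assoc]
  · simp only [mul_assoc]
    rw [← mul_assoc (pruferFactor V T (-Complex.I) E 1 n), ← mul_assoc (star _),
      (Unitary.mem_iff.1 (mul_ringInverse_mem_unitary hs hA hD)).1, one_mul]

theorem exists_star_mul_deriv_eq_star_mul_self (hVsa : ∀ n, 1 ≤ n → IsSelfAdjoint (V n))
    (hTinv : ∀ n, 1 ≤ n → IsUnit (T n)) (n : ℕ) (E : ℝ) :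
    ∃ b : B, (1 / (Complex.I * (n : ℂ))) • (star (pruferFactor V T (-Complex.I) E 1 n
          * Ring.inverse (pruferFactor V T Complex.I E 1 n))
        * deriv (fun E : ℝ => pruferFactor V T (-Complex.I) E 1 n
          * Ring.inverse (pruferFactor V T Complex.I E 1 n)) E) = star b * b := by
  obtain ⟨hD, hA⟩ := isUnit_pruferFactor_ofReal hVsa hTinv E n
  have hs := star_pruferFactor_mul_self hVsa hTinv E n
  obtain ⟨b, hb⟩ := exists_wronskian_eq_star_mul_self hVsa hTinv E n
  have hw := wronskian_identity (homogeneousFrame V T E 1 n).1 (homogeneousFrame V T E 1 n).2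
    (deriv (fun z => (homogeneousFrame V T z 1 n).1) (E : ℂ))
    (deriv (fun z => (homogeneousFrame V T z 1 n).2) (E : ℂ))
  rw [← deriv_pruferFactor, ← deriv_pruferFactor, hb] at hw
  change star (pruferFactor V T (-Complex.I) E 1 n) * _
    - star (pruferFactor V T Complex.I E 1 n) * _ = _ at hw
  rw [(hasDerivAt_pruferFactor_div hVsa hTinv n E).deriv]
  set A := pruferFactor V T (-Complex.I) E 1 n
  set D := pruferFactor V T Complex.I E 1 n
  set A' := deriv (fun z => pruferFactor V T (-Complex.I) z 1 n) (E : ℂ)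
  set D' := deriv (fun z => pruferFactor V T Complex.I z 1 n) (E : ℂ)
  have h1 : star (A * Ring.inverse D) * (A' * Ring.inverse D
      - A * Ring.inverse D * D' * Ring.inverse D)
      = star (Ring.inverse D) * (star A * A' - star D * D') * Ring.inverse D := by
    have e : star A * A * Ring.inverse D = star D := by
      rw [hs, mul_assoc, Ring.mul_inverse_cancel _ hD, mul_one]
    calc _ = star (Ring.inverse D) * (star A * A' - (star A * A * Ring.inverse D) * D')
          * Ring.inverse D := by rw [star_mul]; noncomm_ring
      _ = _ := by rw [e]
  -- The constant is 2i/(in) = 2/n, with 2i from the Wronskian identity.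
  refine ⟨((Real.sqrt (2 / n) : ℝ) : ℂ) • (b * Ring.inverse D), ?_⟩
  rw [h1, hw, star_smul, star_mul, Complex.star_def, Complex.conj_ofReal, smul_mul_smul_comm,
    ← Complex.ofReal_mul, Real.mul_self_sqrt (by positivity), mul_smul_comm, smul_mul_assoc,
    smul_smul]
  congr 1
  · push_cast
    rw [one_div, mul_inv, mul_comm Complex.I⁻¹, mul_assoc, mul_comm 2 Complex.I,
      inv_mul_cancel_left₀ Complex.I_ne_zero]
    ring
  · simp only [mul_assoc]

end PhaseVelocity

/-! ### Matrix form of the phase and the integral of its velocity -/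

section Identification

variable {Ω : Type*} {d : ℕ}

open Matrix in
theorem lagrangianFrame_eq (V T : ℕ → BoundedFamily Ω d) (n : ℕ) (E : ℝ) :
    lagrangianFrame V T n E
      = ![(homogeneousFrame V T E 1 n).1, (homogeneousFrame V T E 1 n).2] := by
  induction n with
  | zero => simp [lagrangianFrame, transferProduct, homogeneousFrame]
  | succ n ih =>
    have h : lagrangianFrame V T (n + 1) E
        = transferOperator (V (n + 1)) (T (n + 1)) E *ᵥ lagrangianFrame V T n E := by
      rw [lagrangianFrame, lagrangianFrame, transferProduct, mulVec_mulVec]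
    rw [h, ih, transferOperator]
    ext i : 1
    fin_cases i
    · simp [homogeneousFrame, mulVec, mul_assoc, sub_eq_add_neg]
    · simp [homogeneousFrame, mulVec]

/-- The sign flips because the adjoint of (1, i)ᵗ conjugates its entries. -/
theorem pruferNumerator_eq (V T : ℕ → BoundedFamily Ω d) (n : ℕ) (E : ℝ) :
    pruferNumerator V T n E = pruferFactor V T (-Complex.I) E 1 n := by
  rw [pruferNumerator, lagrangianFrame_eq, pruferFactor]
  simp only [dotProduct, Fin.sum_univ_two, Pi.star_apply]
  simp

theorem pruferDenominator_eq (V T : ℕ → BoundedFamily Ω d) (n : ℕ) (E : ℝ) :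
    pruferDenominator V T n E = pruferFactor V T Complex.I E 1 n := by
  rw [pruferDenominator, lagrangianFrame_eq, pruferFactor]
  simp only [dotProduct, Fin.sum_univ_two, Pi.star_apply]
  simp

theorem pruferPhase_eq (V T : ℕ → BoundedFamily Ω d) (n : ℕ) :
    pruferPhase V T n = fun E : ℝ => pruferFactor V T (-Complex.I) E 1 n
      * Ring.inverse (pruferFactor V T Complex.I E 1 n) := by
  funext E
  rw [pruferPhase, pruferNumerator_eq, pruferDenominator_eq]

theorem isPositive_star_mul_self_apply (b : BoundedFamily Ω d) (ω : Ω) :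
    ((star b * b) ω).IsPositive := by
  rw [BoundedFamily.mul_apply, BoundedFamily.star_apply, ContinuousLinearMap.star_eq_adjoint]
  exact ContinuousLinearMap.isPositive_adjoint_comp_self (b ω)

variable [TopologicalSpace Ω] [MeasurableSpace Ω] [BorelSpace Ω]
  [AddAction (Fin d → ℤ) Ω] [ContinuousConstVAdd (Fin d → ℤ) Ω]
  {V T : ℕ → BoundedFamily Ω d}

theorem trace_phaseVelocity (P : Measure Ω) [IsProbabilityMeasure P]
    [VAddInvariantMeasure (Fin d → ℤ) Ω P]
    (hV : ∀ n, 1 ≤ n → V n ∈ covariantAlgebra Ω d)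
    (hVsa : ∀ n, 1 ≤ n → IsSelfAdjoint (V n))
    (hT : ∀ n, 1 ≤ n → T n ∈ covariantAlgebra Ω d)
    (hTinv : ∀ n, 1 ≤ n → IsUnit (T n)) {g : BoundedFamily Ω d →L[ℂ] ℂ}
    (hg : ∀ A ∈ covariantAlgebra Ω d, g A = trace P A) (n : ℕ) (E : ℝ) :
    trace P (phaseVelocity V T n E) = 1 / (Complex.I * n)
      * (g (pruferLogDeriv V T (-Complex.I) n E) - g (pruferLogDeriv V T Complex.I n E)) := by
  have hS := isClosed_covariantAlgebra (Ω := Ω) (d := d)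
  have hcomm : ∀ X ∈ covariantAlgebra Ω d, ∀ Y ∈ covariantAlgebra Ω d, g (X * Y) = g (Y * X) :=
    fun X hX Y hY => by
      rw [hg _ (mul_mem hX hY), hg _ (mul_mem hY hX), BoundedFamily.trace_mul_comm P
        (isStronglyContinuous_of_mem hX) (isCovariant_of_mem hX)
        (isStronglyContinuous_of_mem hY) (isCovariant_of_mem hY)]
  have hmem : ∀ ε : ℂ, ∀ z, pruferFactor V T ε z 1 n ∈ covariantAlgebra Ω d :=
    fun ε z => pruferFactor_mem _ hS hV hT ε z 1 n
  have hmem' : ∀ ε z : ℂ, deriv (fun z => pruferFactor V T ε z 1 n) z ∈ covariantAlgebra Ω d :=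
    fun ε z => StarSubalgebra.deriv_mem _ hS (hmem ε) z
  have hinv : ∀ ε z : ℂ, Ring.inverse (pruferFactor V T ε z 1 n) ∈ covariantAlgebra Ω d :=
    fun ε z => StarSubalgebra.ringInverse_mem _ hS (hmem ε z)
  have hlog : pruferLogDeriv V T (-Complex.I) n E ∈ covariantAlgebra Ω d :=
    mul_mem (hinv _ _) (hmem' _ _)
  have hD := (isUnit_pruferFactor_ofReal hVsa hTinv E n).1
  -- Cyclicity removes the conjugation by D from the first term and turns D'D⁻¹ into D⁻¹D' in the
  -- second.
  rw [phaseVelocity, pruferPhase_eq, star_mul_deriv_pruferFactor_div hVsa hTinv, ← hg, map_smul,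
    map_sub, hcomm _ (hmem _ _) _ (mul_mem hlog (hinv _ _)), hcomm _ (hmem' _ _) _ (hinv _ _),
    mul_assoc, Ring.inverse_mul_cancel _ hD, mul_one, smul_eq_mul]
  · rfl
  · exact SMulMemClass.smul_mem _ (sub_mem (mul_mem (hmem _ _) (mul_mem hlog (hinv _ _)))
      (mul_mem (hmem' _ _) (hinv _ _)))

theorem integrable_and_integral_trace_phaseVelocity (P : Measure Ω) [IsProbabilityMeasure P]
    [VAddInvariantMeasure (Fin d → ℤ) Ω P]
    (hV : ∀ n, 1 ≤ n → V n ∈ covariantAlgebra Ω d)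
    (hVsa : ∀ n, 1 ≤ n → IsSelfAdjoint (V n))
    (hT : ∀ n, 1 ≤ n → T n ∈ covariantAlgebra Ω d)
    (hTinv : ∀ n, 1 ≤ n → IsUnit (T n)) {n : ℕ} (hn : n ≠ 0) :
    Integrable (fun E : ℝ => trace P (phaseVelocity V T n E)) ∧
      ∫ E : ℝ, trace P (phaseVelocity V T n E) = 2 * Real.pi := by
  obtain ⟨g, hg⟩ := exists_continuousLinearMap_eq_trace (Ω := Ω) (d := d) P
  have hg1 : g 1 = 1 := by rw [hg 1 (one_mem _), BoundedFamily.trace_one]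
  obtain ⟨hi1, h01⟩ := integrable_and_integral_pruferLogDeriv_sub hVsa hTinv g hg1 (Or.inr rfl) n
  obtain ⟨hi2, h02⟩ := integrable_and_integral_pruferLogDeriv_sub hVsa hTinv g hg1 (Or.inl rfl) n
  have hn' : (n : ℂ) ≠ 0 := Nat.cast_ne_zero.2 hn
  -- The two bracketed differences integrate to zero; the subtracted fractions recombine to 2/(1 +
  -- E²), which carries the whole value 2π.
  have heq : ∀ E : ℝ, trace P (phaseVelocity V T n E) = 1 / (Complex.I * n)
      * ((g (pruferLogDeriv V T (-Complex.I) n E) - n / (E + -Complex.I))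
        - (g (pruferLogDeriv V T Complex.I n E) - n / (E + Complex.I)))
      + 2 * (((1 + E ^ 2)⁻¹ : ℝ) : ℂ) := fun E => by
    rw [trace_phaseVelocity P hV hVsa hT hTinv hg]
    have h1 : (E : ℂ) + -Complex.I ≠ 0 := fun h => by simpa using congrArg Complex.im h
    have h2 : (E : ℂ) + Complex.I ≠ 0 := fun h => by simpa using congrArg Complex.im h
    have h3 : (((1 + E ^ 2)⁻¹ : ℝ) : ℂ) = ((E + -Complex.I) * (E + Complex.I))⁻¹ := by
      push_cast
      congr 1
      linear_combination Complex.I_sq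
    have h4 : 1 / (Complex.I * n) * (n / (E + -Complex.I) - n / (E + Complex.I))
        = 2 * ((E + -Complex.I) * (E + Complex.I))⁻¹ := by
      have hI := Complex.I_ne_zero
      field_simp
      ring
    rw [h3, ← h4]
    ring
  have hr : Integrable fun E : ℝ => 2 * (((1 + E ^ 2)⁻¹ : ℝ) : ℂ) :=
    (integrable_inv_one_add_sq.ofReal).const_mul 2
  have hl := (hi1.sub hi2).const_mul (1 / (Complex.I * n))
  refine ⟨(hl.add hr).congr (Filter.Eventually.of_forall fun E => (heq E).symm), ?_⟩
  calc ∫ E : ℝ, trace P (phaseVelocity V T n E) = _ := integral_congr_ae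
        (Filter.Eventually.of_forall heq)
    _ = _ := integral_add hl hr
    _ = 2 * Real.pi := by
      rw [integral_const_mul, integral_const_mul, integral_complex_ofReal, integral_univ_inv_one_add_sq]
      have h := integral_sub hi1 hi2
      rw [h, h01, h02]
      simp

end Identification

end Prufer
end

/-! ### The main theorem -/

theorem proposition1 {Ω : Type*} [TopologicalSpace Ω] [CompactSpace Ω] [MeasurableSpace Ω]
    [BorelSpace Ω] {d : ℕ} [AddAction (Fin d → ℤ) Ω] [ContinuousConstVAdd (Fin d → ℤ) Ω]
    (P : Measure Ω) [IsProbabilityMeasure P] [VAddInvariantMeasure (Fin d → ℤ) Ω P]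
    (V T : ℕ → Prufer.BoundedFamily Ω d)
    (hV : ∀ n, 1 ≤ n → V n ∈ Prufer.covariantAlgebra Ω d)
    (hVsa : ∀ n, 1 ≤ n → IsSelfAdjoint (V n))
    (hT : ∀ n, 1 ≤ n → T n ∈ Prufer.covariantAlgebra Ω d)
    (hTinv : ∀ n, 1 ≤ n → IsUnit (T n))
    (hT1 : T 1 = 1) (N : ℕ) (hN : 2 ≤ N) :
    (∀ E : ℝ, IsUnit (Prufer.pruferDenominator V T N E) ∧
      Prufer.pruferPhase V T N E ∈ Prufer.covariantAlgebra Ω d ∧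
      Prufer.pruferPhase V T N E ∈ unitary (Prufer.BoundedFamily Ω d) ∧
      DifferentiableAt ℝ (Prufer.pruferPhase V T N) E ∧
      Prufer.phaseVelocity V T N E ∈ Prufer.covariantAlgebra Ω d ∧
      ∀ ω : Ω, (Prufer.phaseVelocity V T N E ω).IsPositive) ∧
    Integrable (fun E : ℝ => Prufer.trace P (Prufer.phaseVelocity V T N E)) ∧
    ∫ E : ℝ, Prufer.trace P (Prufer.phaseVelocity V T N E) = 2 * Real.pi := by
  have hS := Prufer.isClosed_covariantAlgebra (Ω := Ω) (d := d)
  have hphase : ∀ E : ℝ, Prufer.pruferPhase V T N E ∈ Prufer.covariantAlgebra Ω d := fun E => by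
    rw [Prufer.pruferPhase_eq]
    exact mul_mem (Prufer.pruferFactor_mem _ hS hV hT _ _ _ N)
      (StarSubalgebra.ringInverse_mem _ hS (Prufer.pruferFactor_mem _ hS hV hT _ _ _ N))
  refine ⟨fun E => ?_,
    Prufer.integrable_and_integral_trace_phaseVelocity P hV hVsa hT hTinv (by omega)⟩
  obtain ⟨hD, hA⟩ := Prufer.isUnit_pruferFactor_ofReal hVsa hTinv E N
  refine ⟨by rwa [Prufer.pruferDenominator_eq], hphase E, ?_, ?_,
    SMulMemClass.smul_mem _ (mul_mem (star_mem (hphase E))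
      (StarSubalgebra.deriv_mem _ hS hphase E)), fun ω => ?_⟩
  · rw [Prufer.pruferPhase_eq]
    exact Prufer.mul_ringInverse_mem_unitary (Prufer.star_pruferFactor_mul_self hVsa hTinv E N) hA hD
  · rw [Prufer.pruferPhase_eq]
    exact (Prufer.hasDerivAt_pruferFactor_div hVsa hTinv N E).differentiableAt
  · obtain ⟨b, hb⟩ := Prufer.exists_star_mul_deriv_eq_star_mul_self hVsa hTinv N E
    rw [Prufer.phaseVelocity, Prufer.pruferPhase_eq, hb]
    exact Prufer.isPositive_star_mul_self_apply b ω
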